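/- **Lemma (Regret bound for kernelized exponential weights).** *Setting.* Let $\mathcal W\subseteq\mathbb R^d$ be closed, convex and bounded with non-empty interior and Euclidean diameter $W$. Fix $T\in\mathbb N$, contexts $x_1,\dots,x_T$, prediction functions $g_t$ and losses $\ell_t$, all chosen in advance (independently of the learner's randomness); write $g_t(w)=g_t(w;x_t)$ and $f_t(w)=\ell_t(g_t(w))$, and let $\mathcal G_t=g_t(\mathcal W)$. Assume for constants $L,D,C>0$ and $\alpha,\beta\in\mathbb R$ that, for every $t\le T$: * $\ell_t$ takes values in $[0,C]$ on $[\alpha,\beta]$, and is convex and $L$-Lipschitz on $\mathcal G_t$; * $g_t(\mathcal W)\subseteq[\alpha,\beta]$, and $g_t$ is $D$-Lipschitz and not constant on $\mathcal W$. *Kernel.* For a probability measure $q$ on $\mathcal G_t$ with mean $\bar y=\mathbb E_{z\sim q}[z]$ and $\epsilon>0$, define, for $y,y'\in\mathcal G_t$, $$K'_{t,q}(y,y')=\begin{cases}\dfrac{\mathbf 1(y\text{ lies between }y'\text{ and }\bar y)}{|y'-\bar y|},&|y'-\bar y|\ge\epsilon,\\[2mm]\dfrac{\mathbf 1(y\in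 I)}{|I|},\quad I=[\bar y-\epsilon,\bar y]\cap\mathcal G_t,&|y'-\bar y|<\epsilon,\end{cases}$$ where $|I|$ is the length of $I$ (so $I=[\bar y-\epsilon,\bar y]$ and $|I|=\epsilon$ whenever $\bar y-\epsilon\in\mathcal G_t$). Put $K'_tq(y)=\int_{\mathcal G_t}K'_{t,q}(y,y')\,dq(y')$. *Algorithm (parameters $\eta,\epsilon>0$).* Let $p_1$ be the uniform distribution on $\mathcal W$. In round $t=1,\dots,T$ let $q_t$ be the push-forward of $p_t$ under $g_t$; sample, conditionally on the past, $y_t\in\mathcal G_t$ with density $K'_tq_t$; play any $w_t\in\mathcal W$ with $g_t(w_t)=y_t$ (for instance a random one); observe $f_t(w_t)=\ell_t(y_t)$; set $$\tilde f_t(w)=\frac{f_t(w_t)}{K'_tq_t(y_t)}\,K'_{t,q_t}(y_t,g_t(w)),\qquad p_{t+1}(dw)=\frac{e^{-\eta\tilde f_t(w)}\,p_t(dw)}{\int_{\mathcal W}e^{-\eta\tilde f_t(u)}\,p_t(du)}.$$ *Claim.* Let $L'=LDW$, let $B_T=2\big(1+\ln(3LT)+\ln(\beta-\alpha)\big)$,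 and assume $L'T>1$ and $B_T>0$. Run the algorithm with $$\epsilon=\frac1{3LT},\qquad \eta=\Big(\frac{2d\log(L'T)}{B_TC^2T}\Big)^{1/2}.$$ Then each $f_t(w_t)$ is integrable, $\sum_{t=1}^Tf_t$ has a minimizer $w^*$ on $\mathcal W$, and the expected regret satisfies $$\sum_{t=1}^T\mathbb E[f_t(w_t)]-\sum_{t=1}^Tf_t(w^*)\;\le\;4+2\sqrt2\,\sqrt{d\,B_T\,C^2\,T\log(L'T)} .$$ Moreover, for fixed $d,L',L,C,\alpha,\beta$ the right-hand side is $O\big(C\sqrt{dT\log(L'T)}\cdot\sqrt{\log T}\big)$ as $T\to\infty$, i.e. $C\sqrt{dT\log(L'T)}$ up to a factor $\sqrt{\log T}$. -/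

import Mathlib

open MeasureTheory ProbabilityTheory Set Filter Asymptotics
open scoped Topology

noncomputable section

namespace PseudoBandit

/-- The one-dimensional kernel `K'(y, y')` on a prediction interval `G`, built from a distribution
`q` on `G` with mean `m = 𝔼_{z ∼ q}[z]`. As a function of `y` it is the density of the uniform
distribution on the segment between `y'` and `m` if `|y' - m| ≥ ε`, and of the uniform distribution
on `[m - ε, m] ∩ G` if `|y' - m| < ε` (this is `[m - ε, m]` as soon as `m - ε ∈ G`). -/
def smoothingKernel (G : Set ℝ) (q : Measure ℝ) (ε y y' : ℝ) : ℝ :=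
  if ε ≤ |y' - ∫ z, z ∂q| then
    (uIcc y' (∫ z, z ∂q)).indicator 1 y / |y' - ∫ z, z ∂q|
  else
    (Icc ((∫ z, z ∂q) - ε) (∫ z, z ∂q) ∩ G).indicator 1 y /
      volume.real (Icc ((∫ z, z ∂q) - ε) (∫ z, z ∂q) ∩ G)

/-- The smoothed density `K'q(y) = ∫ K'(y, y') dq(y')`. -/
def smoothedDensity (G : Set ℝ) (q : Measure ℝ) (ε y : ℝ) : ℝ :=
  ∫ y', smoothingKernel G q ε y y' ∂q

/-- The distribution on `G` whose Lebesgue density is `K'q`. -/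
def smoothedLaw (G : Set ℝ) (q : Measure ℝ) (ε : ℝ) : Measure ℝ :=
  (volume.restrict G).withDensity fun y => ENNReal.ofReal (smoothedDensity G q ε y)

variable {d : ℕ}

/-- The estimator of the loss function, from the current distribution `p` on the action set `𝒲`,
the sampled prediction `y` and the observed loss `v`:
`u ↦ v / K'q(y) * K'(y, g(u))`, where `q` is the push-forward of `p` under `g`. -/
def lossEstimate (𝒲 : Set (EuclideanSpace ℝ (Fin d))) (g : EuclideanSpace ℝ (Fin d) → ℝ)
    (p : Measure (EuclideanSpace ℝ (Fin d))) (ε y v : ℝ) (u : EuclideanSpace ℝ (Fin d)) : ℝ :=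
  v / smoothedDensity (g '' 𝒲) (p.map g) ε y * smoothingKernel (g '' 𝒲) (p.map g) ε y (g u)

/-- The exponential-weights distributions on the action set `𝒲`, given the sampled predictions
`y 0, y 1, …` and the observed losses `v 0, v 1, …`. The first one is uniform on `𝒲`; the one of
round `t + 1` has a density proportional to `exp (-η * estimate)` with respect to that of
round `t`. Rounds are numbered from `0`. -/
def weights (𝒲 : Set (EuclideanSpace ℝ (Fin d))) (g : ℕ → EuclideanSpace ℝ (Fin d) → ℝ)
    (η ε : ℝ) (y v : ℕ → ℝ) : ℕ → Measure (EuclideanSpace ℝ (Fin d))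
  | 0 => cond volume 𝒲
  | t + 1 => (weights 𝒲 g η ε y v t).tilted fun u =>
      -η * lossEstimate 𝒲 (g t) (weights 𝒲 g η ε y v t) ε (y t) (v t) u

/-- The random sequences `y` (sampled predictions) and `w` (actions) on the probability space
`(Ω, μ)` are a run over `T` rounds of kernelized exponential weights with learning rate `η` and
kernel parameter `ε`, against the prediction functions `g t` and the losses `ℓ t`: in round `t`,
the learner samples `y t` from `K'q`, conditionally on the past, where `q` is the push-forward
under `g t` of the current weights, and then plays some action `w t ∈ 𝒲` with
`g t (w t) = y t`. The only feedback that enters the weights is the value `ℓ t (g t (w t))`. -/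
structure IsRun (𝒲 : Set (EuclideanSpace ℝ (Fin d))) (g : ℕ → EuclideanSpace ℝ (Fin d) → ℝ)
    (ℓ : ℕ → ℝ → ℝ) (η ε : ℝ) (T : ℕ) {Ω : Type*} [MeasurableSpace Ω] (μ : Measure Ω)
    [IsFiniteMeasure μ] (y : ℕ → Ω → ℝ) (w : ℕ → Ω → EuclideanSpace ℝ (Fin d)) : Prop where
  measurable_sample : ∀ t < T, Measurable (y t)
  sample : ∀ t < T, ∀ᵐ ω ∂μ,
    condDistrib (y t) (fun ω' (s : Fin t) => y s ω') μ (fun s : Fin t => y s ω) =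
      smoothedLaw (g t '' 𝒲)
        ((weights 𝒲 g η ε (fun s => y s ω) (fun s => ℓ s (g s (w s ω))) t).map (g t)) ε
  action : ∀ t < T, ∀ᵐ ω ∂μ, w t ω ∈ 𝒲 ∧ g t (w t ω) = y t ω

/-- The expected regret against the comparator `u`:
`∑ 𝔼[ℓ t (g t (w t))] - ∑ ℓ t (g t u)`, over the `T` rounds. -/
def expectedRegret (g : ℕ → EuclideanSpace ℝ (Fin d) → ℝ) (ℓ : ℕ → ℝ → ℝ) (T : ℕ)
    {Ω : Type*} [MeasurableSpace Ω] (μ : Measure Ω) (w : ℕ → Ω → EuclideanSpace ℝ (Fin d))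
    (u : EuclideanSpace ℝ (Fin d)) : ℝ :=
  ∑ t ∈ Finset.range T, ∫ ω, ℓ t (g t (w t ω)) ∂μ - ∑ t ∈ Finset.range T, ℓ t (g t u)

/-- `B = 2 (1 + ln (3LT) + ln (β - α))`. -/
def varianceBound (L α β : ℝ) (T : ℕ) : ℝ :=
  2 * (1 + Real.log (3 * L * T) + Real.log (β - α))

/-- `η = (2 d log (L'T) / (B C² T))^(1/2)`. -/
def learningRate (d : ℕ) (L' B C : ℝ) (T : ℕ) : ℝ :=
  Real.sqrt (2 * d * Real.log (L' * T) / (B * C ^ 2 * T))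

/-- `4 + 2 √2 √(d B C² T log (L'T))`. -/
def regretBound (d : ℕ) (L' B C : ℝ) (T : ℕ) : ℝ :=
  4 + 2 * Real.sqrt 2 * Real.sqrt (d * B * C ^ 2 * T * Real.log (L' * T))

end PseudoBandit

end

namespace PseudoBandit

theorem exists_subgradient {a b m L : ℝ} {f : ℝ → ℝ} (ham : a < m) (hmb : m < b)
    (hf : ConvexOn ℝ (Icc a b) f)
    (hlip : ∀ y ∈ Icc a b, ∀ z ∈ Icc a b, |f y - f z| ≤ L * |y - z|) :
    ∃ s, |s| ≤ L ∧ ∀ y ∈ Icc a b, f m + s * (y - m) ≤ f y := by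
  have hm : m ∈ Icc a b := ⟨ham.le, hmb.le⟩
  have key : ∀ x ∈ Ico a m, ∀ y ∈ Ioc m b, (f m - f x) / (m - x) ≤ (f y - f m) / (y - m) :=
    fun x hx y hy => hf.slope_mono_adjacent ⟨hx.1, hx.2.le.trans hmb.le⟩
      ⟨ham.le.trans hy.1.le, hy.2⟩ hx.2 hy.1
  set A : Set ℝ := (fun x => (f m - f x) / (m - x)) '' Ico a m with hA
  have hAne : A.Nonempty := ⟨_, a, ⟨le_rfl, ham⟩, rfl⟩
  have hAbdd : BddAbove A := ⟨(f b - f m) / (b - m), by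
    rintro _ ⟨x, hx, rfl⟩; exact key x hx b ⟨hmb, le_rfl⟩⟩
  have hsub : ∀ y ∈ Icc a b, f m + sSup A * (y - m) ≤ f y := by
    intro y hy
    rcases lt_trichotomy y m with h | h | h
    · have := le_csSup hAbdd (mem_image_of_mem _ (⟨hy.1, h⟩ : y ∈ Ico a m))
      rw [div_le_iff₀ (sub_pos.2 h)] at this
      linarith
    · simp [h]
    · have : sSup A ≤ (f y - f m) / (y - m) := csSup_le hAne (by
        rintro _ ⟨x, hx, rfl⟩; exact key x hx y ⟨h, hy.2⟩)
      rw [le_div_iff₀ (sub_pos.2 h)] at this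
      linarith
  refine ⟨sSup A, abs_le.2 ⟨?_, ?_⟩, hsub⟩
  · have h1 := hsub a ⟨le_rfl, ham.le.trans hmb.le⟩
    have h2 := (abs_le.1 (hlip a ⟨le_rfl, ham.le.trans hmb.le⟩ m hm)).2
    rw [abs_of_neg (by linarith)] at h2
    nlinarith
  · have h1 := hsub b ⟨ham.le.trans hmb.le, le_rfl⟩
    have h2 := (abs_le.1 (hlip b ⟨ham.le.trans hmb.le, le_rfl⟩ m hm)).2
    rw [abs_of_pos (by linarith)] at h2
    nlinarith

/-- The endpoint `ρ` such that the smoothing kernel `K'(·, y')` on `[a, b]`, for a distribution with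
mean `m`, is the uniform density on the segment between `ρ` and `m`. -/
noncomputable def kernelEnd (a m ε y' : ℝ) : ℝ := if ε ≤ |y' - m| then y' else max (m - ε) a

/-- An upper bound for `sup K'(y, ·)`. -/
noncomputable def kernelBound (a b m ε y : ℝ) : ℝ :=
  if y ≤ m then 1 / max (m - y) (min ε (m - a)) else 1 / max (y - m) (min ε (b - m))

theorem smoothingKernel_Icc {a b ε : ℝ} {q : Measure ℝ} (ham : a < ∫ z, z ∂q)
    (hmb : ∫ z, z ∂q < b) (hε : 0 < ε) (y y' : ℝ) :
    smoothingKernel (Icc a b) q ε y y' =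
      (uIcc (kernelEnd a (∫ z, z ∂q) ε y') (∫ z, z ∂q)).indicator 1 y /
        |kernelEnd a (∫ z, z ∂q) ε y' - ∫ z, z ∂q| := by
  unfold smoothingKernel kernelEnd
  set m := ∫ z, z ∂q
  split_ifs with h
  · rfl
  · have h1 : max (m - ε) a ≤ m := max_le (by linarith) ham.le
    rw [uIcc_of_le h1, Icc_inter_Icc, min_eq_left hmb.le, abs_of_nonpos (by linarith),
      measureReal_def, Real.volume_Icc, ENNReal.toReal_ofReal (by linarith), neg_sub]

section kernelEnd
variable {a b m ε y' : ℝ}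

theorem kernelEnd_mem (ham : a < m) (hmb : m < b) (hε : 0 < ε) (hy' : y' ∈ Icc a b) :
    kernelEnd a m ε y' ∈ Icc a b := by
  unfold kernelEnd
  split_ifs
  · exact hy'
  · exact ⟨le_max_right _ _, max_le (by linarith) (by linarith)⟩

theorem kernelEnd_ne (ham : a < m) (hε : 0 < ε) : kernelEnd a m ε y' ≠ m := by
  unfold kernelEnd
  split_ifs with h
  · rintro rfl; simp at h; linarith
  · exact (max_lt (by linarith) ham).ne

theorem abs_kernelEnd_sub_le (ham : a < m) (hε : 0 < ε) :
    |kernelEnd a m ε y' - y'| ≤ 2 * ε := by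
  unfold kernelEnd
  split_ifs with h
  · simp; linarith
  · obtain ⟨h1, h2⟩ := abs_lt.1 (not_le.1 h)
    have h3 := le_max_left (m - ε) a
    have h4 : max (m - ε) a ≤ m := max_le (by linarith) ham.le
    rw [abs_le]; constructor <;> linarith

theorem measurable_kernelEnd : Measurable fun x : ℝ × ℝ => kernelEnd a x.1 ε x.2 := by
  unfold kernelEnd
  refine Measurable.ite (measurableSet_le measurable_const ?_) ?_ ?_ <;> fun_prop

theorem kernel_le_kernelBound (ham : a < m) (hmb : m < b) (hε : 0 < ε) (y : ℝ) :
    (uIcc (kernelEnd a m ε y') m).indicator 1 y / |kernelEnd a m ε y' - m| ≤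
      kernelBound a b m ε y := by
  have hpos1 : 0 < min ε (m - a) := lt_min hε (by linarith)
  have hpos2 : 0 < min ε (b - m) := lt_min hε (by linarith)
  have hne := kernelEnd_ne (y' := y') ham hε
  have hbn : 0 ≤ kernelBound a b m ε y := by unfold kernelBound; split_ifs <;> positivity
  by_cases hy : y ∈ uIcc (kernelEnd a m ε y') m
  swap
  · rwa [indicator_of_notMem hy, zero_div]
  rw [indicator_of_mem hy, Pi.one_apply]
  unfold kernelBound
  have h0 : (min ε (m - a)) ≤ |kernelEnd a m ε y' - m| := by
    unfold kernelEnd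
    split_ifs with h
    · exact (min_le_left _ _).trans h
    · rw [abs_of_neg (sub_neg.2 (max_lt (by linarith) ham))]
      rcases max_cases (m - ε) a with ⟨h, -⟩ | ⟨h, -⟩ <;> rw [h]
      · exact (min_le_left _ _).trans (by linarith)
      · exact (min_le_right _ _).trans (by linarith)
  rcases lt_or_gt_of_ne hne with hlt | hgt
  · rw [uIcc_of_le hlt.le] at hy
    rw [if_pos hy.2]
    refine one_div_le_one_div_of_le (lt_max_of_lt_right hpos1) (max_le ?_ h0)
    rw [abs_of_neg (by linarith)]; linarith [hy.1]
  · rw [uIcc_of_ge hgt.le] at hy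
    have h3 : ε ≤ |kernelEnd a m ε y' - m| := by
      unfold kernelEnd at hgt ⊢
      split_ifs at hgt ⊢ with h
      · exact h
      · exact absurd hgt (not_lt.2 (max_le (by linarith) ham.le))
    split_ifs with h
    · have : y = m := le_antisymm h hy.1
      subst this
      refine one_div_le_one_div_of_le (lt_max_of_lt_right hpos1) (max_le (by simp) h0)
    · refine one_div_le_one_div_of_le (lt_max_of_lt_right hpos2)
        (max_le ?_ ((min_le_left _ _).trans h3))
      rw [abs_of_pos (by linarith)]; linarith [hy.2]

end kernelEnd

theorem kernelBound_nonneg {a b m ε : ℝ} (ham : a < m) (hmb : m < b) (hε : 0 < ε) (y : ℝ) :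
    0 ≤ kernelBound a b m ε y := by
  have hpos1 : 0 < min ε (m - a) := lt_min hε (by linarith)
  have hpos2 : 0 < min ε (b - m) := lt_min hε (by linarith)
  unfold kernelBound; split_ifs <;> positivity

theorem continuous_one_div_max {δ : ℝ} (hδ : 0 < δ) : Continuous fun x : ℝ => 1 / max x δ :=
  continuous_const.div (by fun_prop) fun x => (lt_max_of_lt_right hδ).ne'

theorem integral_one_div_max {c δ : ℝ} (hδ : 0 < δ) (hc : δ ≤ c) :
    ∫ x in (0 : ℝ)..c, 1 / max x δ = 1 + Real.log (c / δ) := by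
  have hcont := continuous_one_div_max hδ
  rw [← intervalIntegral.integral_add_adjacent_intervals (hcont.intervalIntegrable 0 δ)
    (hcont.intervalIntegrable δ c)]
  congr 1
  · rw [intervalIntegral.integral_congr (g := fun _ => 1 / δ)]
    · simp [hδ.ne']
    · intro x hx
      rw [uIcc_of_le hδ.le] at hx
      simp [max_eq_right hx.2]
  · rw [← integral_one_div_of_pos hδ (hδ.trans_le hc)]
    refine intervalIntegral.integral_congr fun x hx => ?_
    rw [uIcc_of_le hc] at hx
    simp [max_eq_left hx.1]

theorem integral_one_div_max_min_le {c ε r : ℝ} (hc : 0 < c) (hε : 0 < ε) (hr : 1 ≤ r)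
    (hcr : c / ε ≤ r) : ∫ x in (0 : ℝ)..c, 1 / max x (min ε c) ≤ 1 + Real.log r := by
  have hpos : 0 < min ε c := lt_min hε hc
  rw [integral_one_div_max hpos (min_le_right _ _)]
  gcongr
  rcases min_cases ε c with ⟨h, -⟩ | ⟨h, -⟩ <;> rw [h]
  · exact hcr
  · rwa [div_self hc.ne']

theorem measurable_kernelBound {a b m ε : ℝ} : Measurable (kernelBound a b m ε) := by
  unfold kernelBound
  refine Measurable.ite measurableSet_Iic ?_ ?_ <;> fun_prop

theorem lintegral_kernelBound_le {a b m ε r : ℝ} (ham : a < m) (hmb : m < b) (hε : 0 < ε)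
    (hr : 1 ≤ r) (hbr : (b - a) / ε ≤ r) :
    ∫⁻ y in Icc a b, ENNReal.ofReal (kernelBound a b m ε y) ≤
      ENNReal.ofReal (2 * (1 + Real.log r)) := by
  have hpos1 : 0 < min ε (m - a) := lt_min hε (by linarith)
  have hpos2 : 0 < min ε (b - m) := lt_min hε (by linarith)
  have h1 : ∫⁻ y in Ioc a m, ENNReal.ofReal (kernelBound a b m ε y) ≤
      ENNReal.ofReal (1 + Real.log r) := by
    rw [setLIntegral_congr_fun (g := fun y => ENNReal.ofReal (1 / max (m - y) (min ε (m - a))))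
      measurableSet_Ioc fun y hy => by simp only [kernelBound, if_pos hy.2]]
    have hcont : Continuous fun y => 1 / max (m - y) (min ε (m - a)) :=
      (continuous_one_div_max hpos1).comp (continuous_const.sub continuous_id)
    rw [← ofReal_integral_eq_lintegral_ofReal
      ((hcont.intervalIntegrable a m).1) (.of_forall fun y => by positivity),
      ← intervalIntegral.integral_of_le ham.le]
    refine ENNReal.ofReal_le_ofReal ?_
    rw [intervalIntegral.integral_comp_sub_left (fun x => 1 / max x (min ε (m - a))), sub_self]
    refine integral_one_div_max_min_le (by linarith) hε hr (le_trans ?_ hbr)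
    gcongr
  have h2 : ∫⁻ y in Ioc m b, ENNReal.ofReal (kernelBound a b m ε y) ≤
      ENNReal.ofReal (1 + Real.log r) := by
    rw [setLIntegral_congr_fun (g := fun y => ENNReal.ofReal (1 / max (y - m) (min ε (b - m))))
      measurableSet_Ioc fun y hy => by simp only [kernelBound, if_neg (not_le.2 hy.1)]]
    have hcont : Continuous fun y => 1 / max (y - m) (min ε (b - m)) :=
      (continuous_one_div_max hpos2).comp (continuous_id.sub continuous_const)
    rw [← ofReal_integral_eq_lintegral_ofReal
      ((hcont.intervalIntegrable m b).1) (.of_forall fun y => by positivity),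
      ← intervalIntegral.integral_of_le hmb.le]
    refine ENNReal.ofReal_le_ofReal ?_
    rw [intervalIntegral.integral_comp_sub_right (fun x => 1 / max x (min ε (b - m))), sub_self]
    refine integral_one_div_max_min_le (by linarith) hε hr (le_trans ?_ hbr)
    gcongr
  have hlog := Real.log_nonneg hr
  rw [Measure.restrict_congr_set (Ioc_ae_eq_Icc (μ := volume)).symm, ← Ioc_union_Ioc_eq_Ioc ham.le hmb.le,
    lintegral_union measurableSet_Ioc (Ioc_disjoint_Ioc_of_le le_rfl), two_mul,
    ENNReal.ofReal_add (by linarith) (by linarith)]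
  exact add_le_add h1 h2

section average
variable {a b m r : ℝ} {f : ℝ → ℝ}

theorem lintegral_segment_kernel (hr : r ∈ Icc a b) (hm : m ∈ Icc a b) (hne : r ≠ m)
    (hf : Continuous f) (hf0 : ∀ y, 0 ≤ f y) :
    ∫⁻ y in Icc a b, ENNReal.ofReal (f y * ((uIcc r m).indicator 1 y / |r - m|)) =
      ENNReal.ofReal (∫ s in (0 : ℝ)..1, f (m + (r - m) * s)) := by
  have hsub : uIcc r m ⊆ Icc a b := uIcc_subset_Icc hr hm
  have hrm : r - m ≠ 0 := sub_ne_zero.2 hne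
  have e1 : (fun y => ENNReal.ofReal (f y * ((uIcc r m).indicator 1 y / |r - m|))) =
      (uIcc r m).indicator fun y => ENNReal.ofReal (f y / |r - m|) := by
    ext y
    by_cases h : y ∈ uIcc r m <;> simp [h, div_eq_mul_inv]
  rw [e1, setLIntegral_indicator measurableSet_uIcc, inter_eq_self_of_subset_left hsub,
    ← ofReal_integral_eq_lintegral_ofReal, integral_div]
  · congr 1
    rw [intervalIntegral.integral_comp_add_mul _ hrm]
    simp only [mul_zero, add_zero, mul_one, add_sub_cancel, smul_eq_mul]
    rcases lt_or_gt_of_ne hne with h | h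
    · rw [uIcc_of_le h.le, integral_Icc_eq_integral_Ioc, ← intervalIntegral.integral_of_le h.le,
        abs_of_neg (by linarith), intervalIntegral.integral_symm]
      field_simp
    · rw [uIcc_of_ge h.le, integral_Icc_eq_integral_Ioc, ← intervalIntegral.integral_of_le h.le,
        abs_of_pos (by linarith)]
      field_simp
  · exact (hf.div_const _).continuousOn.integrableOn_compact isCompact_uIcc
  · exact .of_forall fun y => div_nonneg (hf0 y) (abs_nonneg _)

theorem average_segment_le (hr : r ∈ Icc a b) (hm : m ∈ Icc a b)
    (hf : Continuous f) (hconv : ConvexOn ℝ (Icc a b) f) :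
    ∫ s in (0 : ℝ)..1, f (m + (r - m) * s) ≤ (f m + f r) / 2 := by
  have h : ∀ s ∈ Icc (0 : ℝ) 1, f (m + (r - m) * s) ≤ (1 - s) * f m + s * f r := by
    intro s hs
    have := hconv.2 hm hr (sub_nonneg.2 hs.2) hs.1 (by ring)
    simp only [smul_eq_mul] at this
    rwa [show m + (r - m) * s = (1 - s) * m + s * r by ring]
  refine (intervalIntegral.integral_mono_on zero_le_one
    (Continuous.intervalIntegrable (by fun_prop) _ _)
    (Continuous.intervalIntegrable (by fun_prop) _ _) h).trans (le_of_eq ?_)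
  rw [intervalIntegral.integral_add (Continuous.intervalIntegrable (by fun_prop) _ _)
    (Continuous.intervalIntegrable (by fun_prop) _ _), intervalIntegral.integral_mul_const,
    intervalIntegral.integral_mul_const,
    intervalIntegral.integral_sub (by simp) (by simp), integral_id]
  simp
  ring

theorem le_average_segment {c : ℝ} (hr : r ∈ Icc a b) (hm : m ∈ Icc a b)
    (hf : Continuous f) (hc : ∀ y ∈ Icc a b, f m + c * (y - m) ≤ f y) :
    f m + c / 2 * (r - m) ≤ ∫ s in (0 : ℝ)..1, f (m + (r - m) * s) := by
  have h : ∀ s ∈ Icc (0 : ℝ) 1, f m + c * (r - m) * s ≤ f (m + (r - m) * s) := by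
    intro s hs
    have hmem : m + (r - m) * s ∈ Icc a b := by
      have := (convex_Icc a b).add_smul_sub_mem hm hr hs
      simpa [mul_comm] using this
    refine le_trans (le_of_eq ?_) (hc _ hmem)
    ring
  refine (le_of_eq ?_).trans (intervalIntegral.integral_mono_on zero_le_one
    (Continuous.intervalIntegrable (by fun_prop) _ _)
    (Continuous.intervalIntegrable (by fun_prop) _ _) h)
  rw [intervalIntegral.integral_add (by simp) (Continuous.intervalIntegrable (by fun_prop) _ _),
    intervalIntegral.integral_const_mul, integral_id]
  simp
  ring

end average


theorem exp_neg_le_one_sub_add_sq {x : ℝ} (hx : 0 ≤ x) : Real.exp (-x) ≤ 1 - x + x ^ 2 / 2 := by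
  have h : MonotoneOn (fun y : ℝ => 1 - y + y ^ 2 / 2 - Real.exp (-y)) (Ici 0) := by
    refine monotoneOn_of_deriv_nonneg (convex_Ici 0) (by fun_prop) (by fun_prop) fun y hy => ?_
    have hd : HasDerivAt (fun y : ℝ => 1 - y + y ^ 2 / 2 - Real.exp (-y))
        (0 - 1 + (2 : ℕ) * y ^ (2 - 1) * 1 / 2 - Real.exp (-y) * (-1)) y :=
      (((hasDerivAt_const y 1).sub (hasDerivAt_id y)).add
        (((hasDerivAt_id y).pow 2).div_const 2)).sub ((hasDerivAt_id y).neg.exp)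
    rw [hd.deriv]
    have := Real.add_one_le_exp (-y)
    norm_num
    linarith
  have := h self_mem_Ici hx hx
  simp only [neg_zero, Real.exp_zero] at this
  linarith

section expWeights
variable {E : Type*} [MeasurableSpace E]

theorem integrable_of_nonneg_le {ν : Measure E} [IsFiniteMeasure ν] {φ : E → ℝ} {M : ℝ}
    (hm : Measurable φ) (h0 : ∀ u, 0 ≤ φ u) (hM : ∀ u, φ u ≤ M) : Integrable φ ν :=
  Integrable.of_bound hm.aestronglyMeasurable M
    (.of_forall fun u => by rw [Real.norm_of_nonneg (h0 u)]; exact hM u)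

theorem integrable_exp_neg {ν : Measure E} [IsFiniteMeasure ν] {φ : E → ℝ}
    (hm : Measurable φ) (h0 : ∀ u, 0 ≤ φ u) : Integrable (fun u => Real.exp (-φ u)) ν :=
  integrable_of_nonneg_le (M := 1) (by fun_prop) (fun u => (Real.exp_pos _).le)
    fun u => Real.exp_le_one_iff.2 (neg_nonpos.2 (h0 u))

theorem log_integral_exp_neg_le {ν : Measure E} [IsProbabilityMeasure ν] {φ : E → ℝ} {M η : ℝ}
    (hη : 0 < η) (hm : Measurable φ) (h0 : ∀ u, 0 ≤ φ u) (hM : ∀ u, φ u ≤ M) :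
    Real.log (∫ u, Real.exp (-η * φ u) ∂ν) ≤
      -η * ∫ u, φ u ∂ν + η ^ 2 / 2 * ∫ u, φ u ^ 2 ∂ν := by
  have hint := integrable_of_nonneg_le (ν := ν) hm h0 hM
  have hint2 : Integrable (fun u => φ u ^ 2) ν :=
    integrable_of_nonneg_le (M := M ^ 2) (by fun_prop) (fun u => sq_nonneg _)
      fun u => pow_le_pow_left₀ (h0 u) (hM u) 2
  have hexp : Integrable (fun u => Real.exp (-η * φ u)) ν := by
    simpa only [neg_mul] using integrable_exp_neg (ν := ν) (φ := fun u => η * φ u)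
      (by fun_prop) fun u => mul_nonneg hη.le (h0 u)
  have h1 : ∫ u, Real.exp (-η * φ u) ∂ν ≤
      1 + (-η * ∫ u, φ u ∂ν + η ^ 2 / 2 * ∫ u, φ u ^ 2 ∂ν) := by
    calc ∫ u, Real.exp (-η * φ u) ∂ν
        ≤ ∫ u, (1 + (-η * φ u + η ^ 2 / 2 * φ u ^ 2)) ∂ν := by
          refine integral_mono hexp
            ((integrable_const _).add ((hint.const_mul _).add (hint2.const_mul _))) fun u => ?_
          have := exp_neg_le_one_sub_add_sq (mul_nonneg hη.le (h0 u))
          rw [neg_mul]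
          refine this.trans (le_of_eq ?_)
          ring
      _ = _ := by
          rw [integral_add (g := fun u => -η * φ u + η ^ 2 / 2 * φ u ^ 2) (integrable_const _)
            ((hint.const_mul _).add (hint2.const_mul _)), integral_add (hint.const_mul _) (hint2.const_mul _), integral_const_mul,
            integral_const_mul]
          simp
  have hpos : 0 < ∫ u, Real.exp (-η * φ u) ∂ν := integral_exp_pos hexp
  have := Real.log_le_sub_one_of_pos hpos
  linarith

/-- A Donsker–Varadhan type lower bound for the partition function, for a comparator uniform on a
set `A`. -/
theorem le_log_integral_exp_neg {ν : Measure E} [IsProbabilityMeasure ν] {φ : E → ℝ} {M : ℝ}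
    (hm : Measurable φ) (h0 : ∀ u, 0 ≤ φ u) (hM : ∀ u, φ u ≤ M)
    {A : Set E} (hA0 : ν A ≠ 0) :
    Real.log (ν.real A) - ∫ u, φ u ∂(ν[|A]) ≤ Real.log (∫ u, Real.exp (-φ u) ∂ν) := by
  have : IsProbabilityMeasure (ν[|A]) := cond_isProbabilityMeasure hA0
  have hApos : 0 < ν.real A := ENNReal.toReal_pos hA0 (measure_ne_top _ _)
  set c := ∫ u, φ u ∂(ν[|A])
  have hint := integrable_of_nonneg_le (ν := ν[|A]) hm h0 hM
  have h1 : Real.exp (-c) ≤ ∫ u, Real.exp (-φ u) ∂(ν[|A]) := by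
    calc Real.exp (-c) = ∫ u, Real.exp (-c) * (1 + c - φ u) ∂(ν[|A]) := by
          rw [integral_const_mul, integral_sub (integrable_const _) hint]
          simp [c]
      _ ≤ _ := by
          refine integral_mono (((integrable_const _).sub hint).const_mul _)
            (integrable_exp_neg hm h0) fun u => ?_
          have := Real.add_one_le_exp (c - φ u)
          calc Real.exp (-c) * (1 + c - φ u) ≤ Real.exp (-c) * Real.exp (c - φ u) := by
                gcongr; linarith
            _ = Real.exp (-φ u) := by rw [← Real.exp_add]; ring_nf
  have h2 : ∫ u, Real.exp (-φ u) ∂(ν[|A]) = (ν.real A)⁻¹ * ∫ u in A, Real.exp (-φ u) ∂ν := by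
    rw [ProbabilityTheory.cond, integral_smul_measure, ENNReal.toReal_inv, smul_eq_mul, measureReal_def]
  have h3 : ∫ u in A, Real.exp (-φ u) ∂ν ≤ ∫ u, Real.exp (-φ u) ∂ν :=
    setIntegral_le_integral (integrable_exp_neg hm h0) (.of_forall fun u => (Real.exp_pos _).le)
  rw [h2, inv_mul_eq_div, le_div_iff₀ hApos] at h1
  have h4 : ν.real A * Real.exp (-c) ≤ ∫ u, Real.exp (-φ u) ∂ν := by linarith
  have := Real.log_le_log (by positivity) h4
  rwa [Real.log_mul hApos.ne' (Real.exp_pos _).ne', Real.log_exp] at this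

variable {p : ℕ → Measure E} {φ : ℕ → E → ℝ} {M : ℕ → ℝ} {η : ℝ}

theorem expWeights_eq_tilted [IsProbabilityMeasure (p 0)] (hη : 0 < η)
    (hp : ∀ t, p (t + 1) = (p t).tilted fun u => -η * φ t u)
    (hm : ∀ t, Measurable (φ t)) (h0 : ∀ t u, 0 ≤ φ t u) (t : ℕ) :
    p t = (p 0).tilted fun u => -(η * ∑ s ∈ Finset.range t, φ s u) := by
  induction t with
  | zero => simp
  | succ t ih =>
    rw [hp, ih, tilted_tilted (integrable_exp_neg (φ := fun u => η * ∑ s ∈ Finset.range t, φ s u)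
      (by fun_prop) fun u => mul_nonneg hη.le (Finset.sum_nonneg fun s _ => h0 s u))]
    congr 1
    ext u
    simp only [Pi.add_apply, Finset.sum_range_succ]
    ring

theorem isProbabilityMeasure_expWeights [IsProbabilityMeasure (p 0)] (hη : 0 < η)
    (hp : ∀ t, p (t + 1) = (p t).tilted fun u => -η * φ t u)
    (hm : ∀ t, Measurable (φ t)) (h0 : ∀ t u, 0 ≤ φ t u) (t : ℕ) :
    IsProbabilityMeasure (p t) := by
  rw [expWeights_eq_tilted hη hp hm h0]
  exact isProbabilityMeasure_tilted
    (integrable_exp_neg (φ := fun u => η * ∑ s ∈ Finset.range t, φ s u)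
      (by fun_prop) fun u => mul_nonneg hη.le (Finset.sum_nonneg fun s _ => h0 s u))

theorem expWeights_regret [IsProbabilityMeasure (p 0)] (hη : 0 < η)
    (hp : ∀ t, p (t + 1) = (p t).tilted fun u => -η * φ t u)
    (hm : ∀ t, Measurable (φ t)) (h0 : ∀ t u, 0 ≤ φ t u) (hM : ∀ t u, φ t u ≤ M t)
    {A : Set E} (hA0 : p 0 A ≠ 0) (T : ℕ) :
    ∑ t ∈ Finset.range T, ∫ u, φ t u ∂(p t) ≤
      -Real.log ((p 0).real A) / η + ∑ t ∈ Finset.range T,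
        (∫ u, φ t u ∂((p 0)[|A]) + η / 2 * ∫ u, φ t u ^ 2 ∂(p t)) := by
  have hF : ∀ t : ℕ, Integrable (fun u => Real.exp (-(η * ∑ s ∈ Finset.range t, φ s u))) (p 0) :=
    fun t => integrable_exp_neg (φ := fun u => η * ∑ s ∈ Finset.range t, φ s u)
      (by fun_prop) fun u => mul_nonneg hη.le (Finset.sum_nonneg fun s _ => h0 s u)
  have upper : ∀ t : ℕ, Real.log (∫ u, Real.exp (-(η * ∑ s ∈ Finset.range t, φ s u)) ∂(p 0)) ≤
      ∑ s ∈ Finset.range t, (-η * ∫ u, φ s u ∂(p s) + η ^ 2 / 2 * ∫ u, φ s u ^ 2 ∂(p s)) := by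
    intro t
    induction t with
    | zero => simp
    | succ t ih =>
      have hprob := isProbabilityMeasure_expWeights hη hp hm h0 t
      have hstep : ∫ u, Real.exp (-(η * ∑ s ∈ Finset.range (t + 1), φ s u)) ∂(p 0) =
          (∫ u, Real.exp (-(η * ∑ s ∈ Finset.range t, φ s u)) ∂(p 0)) *
            ∫ u, Real.exp (-η * φ t u) ∂(p t) := by
        rw [expWeights_eq_tilted hη hp hm h0 t, integral_exp_tilted,
          mul_div_cancel₀ _ (integral_exp_pos (hF t)).ne']
        refine integral_congr_ae (.of_forall fun u => ?_)
        simp only [Pi.add_apply, Finset.sum_range_succ]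
        ring_nf
      have hexp : Integrable (fun u => Real.exp (-η * φ t u)) (p t) := by
        simpa only [neg_mul] using integrable_exp_neg (ν := p t) (φ := fun u => η * φ t u)
          ((hm t).const_mul η) fun u => mul_nonneg hη.le (h0 t u)
      rw [hstep, Real.log_mul (integral_exp_pos (hF t)).ne' (integral_exp_pos hexp).ne',
        Finset.sum_range_succ]
      exact add_le_add ih (log_integral_exp_neg_le hη (hm t) (h0 t) (hM t))
  have lower := le_log_integral_exp_neg (ν := p 0)
    (φ := fun u => η * ∑ s ∈ Finset.range T, φ s u) (M := η * ∑ s ∈ Finset.range T, M s)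
    (by fun_prop) (fun u => mul_nonneg hη.le (Finset.sum_nonneg fun s _ => h0 s u))
    (fun u => mul_le_mul_of_nonneg_left (Finset.sum_le_sum fun s _ => hM s u) hη.le) hA0
  have : IsProbabilityMeasure ((p 0)[|A]) := cond_isProbabilityMeasure hA0
  rw [integral_const_mul, integral_finsetSum _ fun s _ =>
    integrable_of_nonneg_le (hm s) (h0 s) (hM s)] at lower
  have hcomb := lower.trans (upper T)
  rw [Finset.sum_add_distrib, ← Finset.mul_sum, ← Finset.mul_sum] at hcomb
  rw [Finset.sum_add_distrib, ← Finset.mul_sum]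
  have : η * ∑ t ∈ Finset.range T, ∫ u, φ t u ∂(p t) ≤
      -Real.log ((p 0).real A) + η * (∑ t ∈ Finset.range T, ∫ u, φ t u ∂((p 0)[|A]) +
        η / 2 * ∑ t ∈ Finset.range T, ∫ u, φ t u ^ 2 ∂(p t)) := by linarith
  rw [← le_div_iff₀' hη] at this
  refine this.trans (le_of_eq ?_)
  field_simp

end expWeights

theorem ofReal_integral_le_lintegral {E : Type*} [MeasurableSpace E] {ν : Measure E} (h : E → ℝ) :
    ENNReal.ofReal (∫ u, h u ∂ν) ≤ ∫⁻ u, ENNReal.ofReal (h u) ∂ν := by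
  by_cases hh : Integrable h ν
  · refine (ENNReal.ofReal_le_ofReal (integral_mono hh hh.pos_part fun u => le_max_left _ _)).trans ?_
    rw [ofReal_integral_eq_lintegral_ofReal hh.pos_part (.of_forall fun u => le_max_right _ _)]
    simp
  · simp [integral_undef hh]

theorem measurable_uIcc_indicator :
    Measurable fun x : (ℝ × ℝ) × ℝ => (uIcc x.1.1 x.1.2).indicator (1 : ℝ → ℝ) x.2 := by
  have : (fun x : (ℝ × ℝ) × ℝ => (uIcc x.1.1 x.1.2).indicator (1 : ℝ → ℝ) x.2) =
      {x : (ℝ × ℝ) × ℝ | min x.1.1 x.1.2 ≤ x.2 ∧ x.2 ≤ max x.1.1 x.1.2}.indicator 1 := by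
    ext x
    by_cases h : min x.1.1 x.1.2 ≤ x.2 ∧ x.2 ≤ max x.1.1 x.1.2
    · rw [indicator_of_mem (by exact h), indicator_of_mem (by exact h)]; rfl
    · rw [indicator_of_notMem (by exact h), indicator_of_notMem (by exact h)]
  rw [this]
  have h1 : Measurable fun x : (ℝ × ℝ) × ℝ => min x.1.1 x.1.2 := by fun_prop
  have h2 : Measurable fun x : (ℝ × ℝ) × ℝ => max x.1.1 x.1.2 := by fun_prop
  exact measurable_one.indicator
    ((measurableSet_le h1 measurable_snd).inter (measurableSet_le measurable_snd h2))

/-- The smoothing kernel as an explicit measurable function of `(m, y, y')`. -/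
theorem measurable_segment_kernel (a ε : ℝ) : Measurable fun x : ℝ × ℝ × ℝ =>
    (uIcc (kernelEnd a x.1 ε x.2.2) x.1).indicator (1 : ℝ → ℝ) x.2.1 /
      |kernelEnd a x.1 ε x.2.2 - x.1| := by
  have h1 : Measurable fun x : ℝ × ℝ × ℝ => kernelEnd a x.1 ε x.2.2 :=
    measurable_kernelEnd.comp (measurable_fst.prodMk measurable_snd.snd)
  refine Measurable.div ?_ (by fun_prop)
  exact measurable_uIcc_indicator.comp
    ((h1.prodMk measurable_fst).prodMk measurable_snd.fst)

section round
variable {a b ε : ℝ} {q : Measure ℝ}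

theorem measurable_smoothingKernel (ham : a < ∫ z, z ∂q) (hmb : ∫ z, z ∂q < b) (hε : 0 < ε) :
    Measurable fun x : ℝ × ℝ => smoothingKernel (Icc a b) q ε x.1 x.2 := by
  have e : (fun x : ℝ × ℝ => smoothingKernel (Icc a b) q ε x.1 x.2) = fun x => _ :=
    funext fun x => smoothingKernel_Icc ham hmb hε x.1 x.2
  rw [e]
  have h := (measurable_segment_kernel a ε).comp (measurable_prodMk_left (x := ∫ z, z ∂q))
  simpa only [Function.comp_def] using h

theorem smoothingKernel_nonneg (ham : a < ∫ z, z ∂q) (hmb : ∫ z, z ∂q < b) (hε : 0 < ε)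
    (y y' : ℝ) : 0 ≤ smoothingKernel (Icc a b) q ε y y' := by
  rw [smoothingKernel_Icc ham hmb hε]
  exact div_nonneg (indicator_nonneg (fun _ _ => zero_le_one) _) (abs_nonneg _)

theorem smoothingKernel_le (ham : a < ∫ z, z ∂q) (hmb : ∫ z, z ∂q < b) (hε : 0 < ε)
    (y y' : ℝ) : smoothingKernel (Icc a b) q ε y y' ≤ kernelBound a b (∫ z, z ∂q) ε y := by
  rw [smoothingKernel_Icc ham hmb hε]
  exact kernel_le_kernelBound ham hmb hε y

theorem integrable_smoothingKernel [IsFiniteMeasure q] (ham : a < ∫ z, z ∂q)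
    (hmb : ∫ z, z ∂q < b) (hε : 0 < ε) (y : ℝ) :
    Integrable (smoothingKernel (Icc a b) q ε y) q :=
  integrable_of_nonneg_le
    ((measurable_smoothingKernel ham hmb hε).comp (measurable_const.prodMk measurable_id))
    (smoothingKernel_nonneg ham hmb hε y) (smoothingKernel_le ham hmb hε y)

theorem smoothedDensity_nonneg (ham : a < ∫ z, z ∂q) (hmb : ∫ z, z ∂q < b) (hε : 0 < ε)
    (y : ℝ) : 0 ≤ smoothedDensity (Icc a b) q ε y :=
  integral_nonneg (smoothingKernel_nonneg ham hmb hε y)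

theorem measurable_smoothedDensity [SFinite q] (ham : a < ∫ z, z ∂q) (hmb : ∫ z, z ∂q < b)
    (hε : 0 < ε) : Measurable (smoothedDensity (Icc a b) q ε) :=
  ((measurable_smoothingKernel ham hmb hε).stronglyMeasurable.integral_prod_right).measurable

theorem lintegral_smoothedLaw [SFinite q] (ham : a < ∫ z, z ∂q) (hmb : ∫ z, z ∂q < b)
    (hε : 0 < ε) (F : ℝ → ENNReal) (hF : Measurable F) :
    ∫⁻ y, F y ∂(smoothedLaw (Icc a b) q ε) =
      ∫⁻ y in Icc a b, ENNReal.ofReal (smoothedDensity (Icc a b) q ε y) * F y := by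
  rw [smoothedLaw, lintegral_withDensity_eq_lintegral_mul _
    (measurable_smoothedDensity ham hmb hε).ennreal_ofReal hF]
  rfl

variable {f : ℝ → ℝ} {L C : ℝ}

theorem lintegral_mul_smoothingKernel (ham : a < ∫ z, z ∂q) (hmb : ∫ z, z ∂q < b) (hε : 0 < ε)
    (hf : Continuous f) (hf0 : ∀ y, 0 ≤ f y) {y' : ℝ} (hy' : y' ∈ Icc a b) :
    ∫⁻ y in Icc a b, ENNReal.ofReal (f y * smoothingKernel (Icc a b) q ε y y') =
      ENNReal.ofReal (∫ s in (0 : ℝ)..1, f ((∫ z, z ∂q) +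
        (kernelEnd a (∫ z, z ∂q) ε y' - ∫ z, z ∂q) * s)) := by
  simp only [smoothingKernel_Icc ham hmb hε]
  exact lintegral_segment_kernel (kernelEnd_mem ham hmb hε hy') ⟨ham.le, hmb.le⟩
    (kernelEnd_ne ham hε) hf hf0

theorem lintegral_mul_smoothingKernel_le (ham : a < ∫ z, z ∂q) (hmb : ∫ z, z ∂q < b)
    (hε : 0 < ε) (hL : 0 ≤ L) (hf : Continuous f) (hf0 : ∀ y, 0 ≤ f y)
    (hconv : ConvexOn ℝ (Icc a b) f)
    (hlip : ∀ y ∈ Icc a b, ∀ z ∈ Icc a b, |f y - f z| ≤ L * |y - z|)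
    {y' : ℝ} (hy' : y' ∈ Icc a b) :
    ∫⁻ y in Icc a b, ENNReal.ofReal (f y * smoothingKernel (Icc a b) q ε y y') ≤
      ENNReal.ofReal ((f (∫ z, z ∂q) + f y') / 2 + L * ε) := by
  rw [lintegral_mul_smoothingKernel ham hmb hε hf hf0 hy']
  have hr := kernelEnd_mem ham hmb hε hy'
  have h1 := average_segment_le hr ⟨ham.le, hmb.le⟩ hf hconv
  have h2 := (abs_le.1 (hlip _ hr _ hy')).2
  have h3 := mul_le_mul_of_nonneg_left (abs_kernelEnd_sub_le (y' := y') ham hε) hL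
  exact ENNReal.ofReal_le_ofReal (by linarith)

theorem le_lintegral_smoothedLaw [IsProbabilityMeasure q] (ham : a < ∫ z, z ∂q)
    (hmb : ∫ z, z ∂q < b) (hε : 0 < ε) (hf : Continuous f) (hf0 : ∀ y, 0 ≤ f y)
    (hconv : ConvexOn ℝ (Icc a b) f)
    (hlip : ∀ y ∈ Icc a b, ∀ z ∈ Icc a b, |f y - f z| ≤ L * |y - z|)
    (hq : ∀ᵐ z ∂q, z ∈ Icc a b) :
    ENNReal.ofReal (f (∫ z, z ∂q) - L * ε) ≤
      ∫⁻ y, ENNReal.ofReal (f y) ∂(smoothedLaw (Icc a b) q ε) := by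
  obtain ⟨s, hsL, hs⟩ := exists_subgradient ham hmb hconv hlip
  have hk := measurable_smoothingKernel ham hmb hε
  set m := ∫ z, z ∂q with hm
  have hidint : Integrable (fun z : ℝ => z) q :=
    Integrable.of_bound measurable_id.aestronglyMeasurable (max |a| |b|)
      (hq.mono fun z hz => abs_le_max_abs_abs hz.1 hz.2)
  have h1 : ∫ z, (f m - L * ε + s / 2 * (z - m)) ∂q = f m - L * ε := by
    rw [integral_add (g := fun z => s / 2 * (z - m)) (integrable_const _)
      ((hidint.sub (integrable_const _)).const_mul _), integral_const_mul, integral_sub hidint (integrable_const _)]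
    simp [← hm]
  calc ENNReal.ofReal (f m - L * ε)
      ≤ ∫⁻ z, ENNReal.ofReal (f m - L * ε + s / 2 * (z - m)) ∂q := by
        have h2 := ofReal_integral_le_lintegral (ν := q) fun z => f m - L * ε + s / 2 * (z - m)
        rwa [h1] at h2
    _ ≤ ∫⁻ z, (∫⁻ y in Icc a b, ENNReal.ofReal (f y * smoothingKernel (Icc a b) q ε y z)) ∂q := by
        refine lintegral_mono_ae (hq.mono fun z hz => ?_)
        rw [lintegral_mul_smoothingKernel ham hmb hε hf hf0 hz]
        have hr := kernelEnd_mem ham hmb hε hz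
        refine ENNReal.ofReal_le_ofReal (le_trans ?_
          (le_average_segment hr ⟨ham.le, hmb.le⟩ hf hs))
        have h3 : s * (z - kernelEnd a m ε z) ≤ L * (2 * ε) := by
          refine (le_abs_self _).trans ?_
          rw [abs_mul, abs_sub_comm]
          exact mul_le_mul hsL (abs_kernelEnd_sub_le ham hε) (abs_nonneg _)
            ((abs_nonneg _).trans hsL)
        linarith
    _ = ∫⁻ y in Icc a b, ∫⁻ z, ENNReal.ofReal (f y * smoothingKernel (Icc a b) q ε y z) ∂q := by
        refine lintegral_lintegral_swap (Measurable.aemeasurable ?_)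
        exact ((hf.measurable.comp measurable_snd).mul
          (hk.comp measurable_swap)).ennreal_ofReal
    _ = _ := by
        rw [lintegral_smoothedLaw ham hmb hε _ hf.measurable.ennreal_ofReal]
        refine lintegral_congr fun y => ?_
        rw [← ofReal_integral_eq_lintegral_ofReal
          ((integrable_smoothingKernel ham hmb hε y).const_mul _)
          (.of_forall fun z => mul_nonneg (hf0 y) (smoothingKernel_nonneg ham hmb hε y z)),
          integral_const_mul, ← ENNReal.ofReal_mul (smoothedDensity_nonneg ham hmb hε y),
          mul_comm]
        rfl

theorem lintegral_estimate_le [IsFiniteMeasure q] (ham : a < ∫ z, z ∂q) (hmb : ∫ z, z ∂q < b)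
    (hε : 0 < ε) (hL : 0 ≤ L) (hf : Continuous f) (hf0 : ∀ y, 0 ≤ f y)
    (hconv : ConvexOn ℝ (Icc a b) f)
    (hlip : ∀ y ∈ Icc a b, ∀ z ∈ Icc a b, |f y - f z| ≤ L * |y - z|)
    {y' : ℝ} (hy' : y' ∈ Icc a b) :
    ∫⁻ y, ENNReal.ofReal (f y / smoothedDensity (Icc a b) q ε y *
        smoothingKernel (Icc a b) q ε y y') ∂(smoothedLaw (Icc a b) q ε) ≤
      ENNReal.ofReal ((f (∫ z, z ∂q) + f y') / 2 + L * ε) := by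
  have hk : Measurable fun y => smoothingKernel (Icc a b) q ε y y' :=
    (measurable_smoothingKernel ham hmb hε).comp (measurable_id.prodMk measurable_const)
  rw [lintegral_smoothedLaw ham hmb hε]
  swap
  · exact ((hf.measurable.div (measurable_smoothedDensity ham hmb hε)).mul hk).ennreal_ofReal
  refine le_trans (lintegral_mono fun y => ?_)
    (lintegral_mul_smoothingKernel_le ham hmb hε hL hf hf0 hconv hlip hy')
  have h0 := smoothedDensity_nonneg ham hmb hε y
  rw [← ENNReal.ofReal_mul h0]
  refine ENNReal.ofReal_le_ofReal ?_
  rcases h0.eq_or_lt with h | h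
  · rw [← h]
    simpa using mul_nonneg (hf0 y) (smoothingKernel_nonneg ham hmb hε y y')
  · refine le_of_eq ?_
    field_simp

end round

section estimate
variable {E : Type*} [MeasurableSpace E] {p pstar : Measure E} {g : E → ℝ} {a b ε L C r c η : ℝ} {f : ℝ → ℝ}

theorem integral_estimate (hg : Measurable g) (hm : ∫ z, z ∂(p.map g) ∈ Ioo a b) (hε : 0 < ε)
    {y : ℝ} (hy : smoothedDensity (Icc a b) (p.map g) ε y ≠ 0) :
    ∫ u, f y / smoothedDensity (Icc a b) (p.map g) ε y *
      smoothingKernel (Icc a b) (p.map g) ε y (g u) ∂p = f y := by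
  have hk : Measurable (smoothingKernel (Icc a b) (p.map g) ε y) :=
    (measurable_smoothingKernel hm.1 hm.2 hε).comp (measurable_const.prodMk measurable_id)
  rw [integral_const_mul, ← integral_map (φ := g) (f := smoothingKernel (Icc a b) (p.map g) ε y)
    hg.aemeasurable hk.aestronglyMeasurable]
  exact div_mul_cancel₀ _ hy

theorem integral_estimate_sq_le [IsProbabilityMeasure p] (hg : Measurable g) (hm : ∫ z, z ∂(p.map g) ∈ Ioo a b)
    (hε : 0 < ε) (hf0 : ∀ y, 0 ≤ f y) (hfC : ∀ y, f y ≤ C) (y : ℝ) :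
    smoothedDensity (Icc a b) (p.map g) ε y *
      ∫ u, (f y / smoothedDensity (Icc a b) (p.map g) ε y *
        smoothingKernel (Icc a b) (p.map g) ε y (g u)) ^ 2 ∂p ≤
      C ^ 2 * kernelBound a b (∫ z, z ∂(p.map g)) ε y := by
  have : IsProbabilityMeasure (p.map g) := Measure.isProbabilityMeasure_map hg.aemeasurable
  have hk : Measurable (smoothingKernel (Icc a b) (p.map g) ε y) :=
    (measurable_smoothingKernel hm.1 hm.2 hε).comp (measurable_const.prodMk measurable_id)
  have hS := kernelBound_nonneg hm.1 hm.2 hε y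
  have h0 := smoothedDensity_nonneg hm.1 hm.2 hε y
  have hfC2 : f y ^ 2 ≤ C ^ 2 := pow_le_pow_left₀ (hf0 y) (hfC y) 2
  set κ := smoothedDensity (Icc a b) (p.map g) ε y with hκ
  rcases h0.eq_or_lt with h | h
  · rw [← h, zero_mul]; positivity
  simp only [mul_pow]
  rw [integral_const_mul]
  have h1 : ∫ u, smoothingKernel (Icc a b) (p.map g) ε y (g u) ^ 2 ∂p ≤
      kernelBound a b (∫ z, z ∂(p.map g)) ε y * κ := by
    rw [hκ, smoothedDensity, ← integral_const_mul, integral_map hg.aemeasurable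
      (by fun_prop)]
    refine integral_mono_of_nonneg (.of_forall fun u => sq_nonneg _) ?_ (.of_forall fun u => ?_)
    · exact ((integrable_smoothingKernel hm.1 hm.2 hε y).comp_measurable hg).const_mul _
    · simp only [sq]
      exact mul_le_mul_of_nonneg_right (smoothingKernel_le hm.1 hm.2 hε _ _)
        (smoothingKernel_nonneg hm.1 hm.2 hε _ _)
  calc κ * ((f y / κ) ^ 2 * ∫ u, smoothingKernel (Icc a b) (p.map g) ε y (g u) ^ 2 ∂p)
      ≤ κ * ((f y / κ) ^ 2 * (kernelBound a b (∫ z, z ∂(p.map g)) ε y * κ)) := by gcongr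
    _ = f y ^ 2 * kernelBound a b (∫ z, z ∂(p.map g)) ε y := by field_simp
    _ ≤ _ := by gcongr

/-- The one-round inequality for kernelized exponential weights. -/
theorem lintegral_round_le [IsProbabilityMeasure p] [IsProbabilityMeasure pstar] (hg : Measurable g) (hm : ∫ z, z ∂(p.map g) ∈ Ioo a b)
    (hε : 0 < ε) (hL : 0 ≤ L) (hη : 0 ≤ η) (hc : 0 ≤ c) (hf : Continuous f)
    (hf0 : ∀ y, 0 ≤ f y) (hfC : ∀ y, f y ≤ C) (hconv : ConvexOn ℝ (Icc a b) f)
    (hlip : ∀ y ∈ Icc a b, ∀ z ∈ Icc a b, |f y - f z| ≤ L * |y - z|)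
    (hr : 1 ≤ r) (hbr : (b - a) / ε ≤ r) (hp : ∀ᵐ u ∂p, g u ∈ Icc a b)
    (hpstar : ∀ᵐ u ∂pstar, g u ∈ Icc a b ∧ f (g u) ≤ c)
    (φ : ℝ → E → ℝ) (hφ : φ = fun y u => f y / smoothedDensity (Icc a b) (p.map g) ε y *
        smoothingKernel (Icc a b) (p.map g) ε y (g u)) :
    ∫⁻ y, ENNReal.ofReal ((f y - ∫ u, φ y u ∂p) + ∫ u, φ y u ∂pstar +
        η / 2 * ∫ u, φ y u ^ 2 ∂p) ∂(smoothedLaw (Icc a b) (p.map g) ε) ≤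
      ENNReal.ofReal (1 / 2) *
        ∫⁻ y, ENNReal.ofReal (f y) ∂(smoothedLaw (Icc a b) (p.map g) ε) +
      ENNReal.ofReal (c / 2 + 3 / 2 * (L * ε) + η / 2 * (C ^ 2 * (2 * (1 + Real.log r)))) := by
  have : IsProbabilityMeasure (p.map g) := Measure.isProbabilityMeasure_map hg.aemeasurable
  set q := p.map g with hq
  set m := ∫ z, z ∂q
  have hκm := measurable_smoothedDensity hm.1 hm.2 hε
  have hφm : Measurable (Function.uncurry φ) := by
    rw [hφ]
    refine ((hf.measurable.comp measurable_fst).div (hκm.comp measurable_fst)).mul ?_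
    exact (measurable_smoothingKernel hm.1 hm.2 hε).comp
      (measurable_fst.prodMk (hg.comp measurable_snd))
  have hqG : ∀ᵐ z ∂q, z ∈ Icc a b := by
    exact (ae_map_iff hg.aemeasurable measurableSet_Icc).2 hp
  have hlog := Real.log_nonneg hr
  have hm1 : Measurable fun y => f y - ∫ u, φ y u ∂p :=
    hf.measurable.sub hφm.stronglyMeasurable.integral_prod_right.measurable
  have hm2 : Measurable fun y => ∫ u, φ y u ∂pstar :=
    hφm.stronglyMeasurable.integral_prod_right.measurable
  have hm3 : Measurable fun y => η / 2 * ∫ u, φ y u ^ 2 ∂p :=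
    ((hφm.pow_const 2).stronglyMeasurable.integral_prod_right').measurable.const_mul _
  have t1 : ∫⁻ y, ENNReal.ofReal (f y - ∫ u, φ y u ∂p) ∂(smoothedLaw (Icc a b) q ε) = 0 := by
    rw [lintegral_smoothedLaw hm.1 hm.2 hε _ hm1.ennreal_ofReal]
    refine (lintegral_congr fun y => ?_).trans lintegral_zero
    by_cases hy : smoothedDensity (Icc a b) q ε y = 0
    · simp [hy]
    · rw [hφ, integral_estimate hg hm hε hy]; simp
  have t2 : ∫⁻ y, ENNReal.ofReal (∫ u, φ y u ∂pstar) ∂(smoothedLaw (Icc a b) q ε) ≤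
      ENNReal.ofReal ((f m + c) / 2 + L * ε) := by
    calc _ ≤ ∫⁻ y, ∫⁻ u, ENNReal.ofReal (φ y u) ∂pstar ∂(smoothedLaw (Icc a b) q ε) :=
          lintegral_mono fun y => ofReal_integral_le_lintegral _
      _ = ∫⁻ u, ∫⁻ y, ENNReal.ofReal (φ y u) ∂(smoothedLaw (Icc a b) q ε) ∂pstar := by
          have : SFinite (smoothedLaw (Icc a b) q ε) := by
            unfold smoothedLaw; infer_instance
          exact lintegral_lintegral_swap hφm.ennreal_ofReal.aemeasurable
      _ ≤ ∫⁻ u, ENNReal.ofReal ((f m + c) / 2 + L * ε) ∂pstar := by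
          refine lintegral_mono_ae (hpstar.mono fun u hu => ?_)
          rw [hφ]
          refine (lintegral_estimate_le hm.1 hm.2 hε hL hf hf0 hconv hlip hu.1).trans ?_
          exact ENNReal.ofReal_le_ofReal (by linarith [hu.2])
      _ = _ := by simp
  have t3 : ∫⁻ y, ENNReal.ofReal (η / 2 * ∫ u, φ y u ^ 2 ∂p) ∂(smoothedLaw (Icc a b) q ε) ≤
      ENNReal.ofReal (η / 2 * (C ^ 2 * (2 * (1 + Real.log r)))) := by
    rw [lintegral_smoothedLaw hm.1 hm.2 hε _ hm3.ennreal_ofReal]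
    calc _ ≤ ∫⁻ y in Icc a b, ENNReal.ofReal (η / 2 * C ^ 2) *
          ENNReal.ofReal (kernelBound a b m ε y) := by
          refine lintegral_mono fun y => ?_
          rw [← ENNReal.ofReal_mul (smoothedDensity_nonneg hm.1 hm.2 hε y),
            ← ENNReal.ofReal_mul (by positivity)]
          refine ENNReal.ofReal_le_ofReal ?_
          have := mul_le_mul_of_nonneg_left (integral_estimate_sq_le hg hm hε hf0 hfC y)
            (by positivity : 0 ≤ η / 2)
          rw [hφ]
          linarith
      _ ≤ _ := by
          rw [lintegral_const_mul _ measurable_kernelBound.ennreal_ofReal, ← mul_assoc,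
            ENNReal.ofReal_mul (p := η / 2 * C ^ 2) (by positivity)]
          gcongr
          exact lintegral_kernelBound_le hm.1 hm.2 hε hr hbr
  have t4 := le_lintegral_smoothedLaw hm.1 hm.2 hε hf hf0 hconv hlip hqG
  calc _ ≤ ∫⁻ y, (ENNReal.ofReal (f y - ∫ u, φ y u ∂p) + ENNReal.ofReal (∫ u, φ y u ∂pstar) +
        ENNReal.ofReal (η / 2 * ∫ u, φ y u ^ 2 ∂p)) ∂(smoothedLaw (Icc a b) q ε) :=
        lintegral_mono fun y => ENNReal.ofReal_add_le.trans
          (add_le_add_left ENNReal.ofReal_add_le _)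
    _ ≤ 0 + ENNReal.ofReal ((f m + c) / 2 + L * ε) +
        ENNReal.ofReal (η / 2 * (C ^ 2 * (2 * (1 + Real.log r)))) := by
        rw [lintegral_add_right _ hm3.ennreal_ofReal, lintegral_add_right _ hm2.ennreal_ofReal, t1]
        gcongr
    _ ≤ ENNReal.ofReal (1 / 2) * ENNReal.ofReal (f m - L * ε) +
        ENNReal.ofReal (c / 2 + 3 / 2 * (L * ε) + η / 2 * (C ^ 2 * (2 * (1 + Real.log r)))) := by
        rw [zero_add, ← ENNReal.ofReal_mul (by norm_num), ENNReal.ofReal_add (p := _ + _)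
          (by positivity) (by positivity), ← add_assoc]
        gcongr
        refine le_trans (ENNReal.ofReal_le_ofReal (le_of_eq ?_)) ENNReal.ofReal_add_le
        ring
    _ ≤ _ := by gcongr

end estimate

section weights
variable {d : ℕ} {𝒲 : Set (EuclideanSpace ℝ (Fin d))} {η ε : ℝ}

theorem weights_ae_mem (h𝒲 : MeasurableSet 𝒲) (g : ℕ → EuclideanSpace ℝ (Fin d) → ℝ)
    (y v : ℕ → ℝ) (t : ℕ) : ∀ᵐ u ∂(weights 𝒲 g η ε y v t), u ∈ 𝒲 := by
  induction t with
  | zero => exact ae_cond_mem h𝒲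
  | succ t ih => exact (tilted_absolutelyContinuous _ _).ae_le ih

theorem weights_congr (h𝒲 : MeasurableSet 𝒲) {g g' : ℕ → EuclideanSpace ℝ (Fin d) → ℝ}
    {y y' v v' : ℕ → ℝ} {t : ℕ} (hg : ∀ s < t, EqOn (g s) (g' s) 𝒲)
    (hy : ∀ s < t, y s = y' s) (hv : ∀ s < t, v s = v' s) :
    weights 𝒲 g η ε y v t = weights 𝒲 g' η ε y' v' t := by
  induction t with
  | zero => rfl
  | succ t ih =>
    have ih' := ih (fun s hs => hg s (hs.trans t.lt_succ_self))
      (fun s hs => hy s (hs.trans t.lt_succ_self)) (fun s hs => hv s (hs.trans t.lt_succ_self))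
    have hmem : ∀ᵐ u ∂(weights 𝒲 g' η ε y' v' t), g t u = g' t u :=
      (weights_ae_mem h𝒲 g' y' v' t).mono fun u hu => hg t t.lt_succ_self hu
    simp only [weights]
    rw [ih']
    refine tilted_congr (hmem.mono fun u hu => ?_)
    simp only [lossEstimate]
    rw [hy t t.lt_succ_self, hv t t.lt_succ_self, (hg t t.lt_succ_self).image_eq,
      Measure.map_congr hmem, hu]

end weights

/-- Prediction functions and losses, extended regularly to the whole space and to all rounds. -/
structure RegularGame {d : ℕ} (𝒲 : Set (EuclideanSpace ℝ (Fin d)))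
    (g : ℕ → EuclideanSpace ℝ (Fin d) → ℝ) (f : ℕ → ℝ → ℝ) (a b : ℕ → ℝ) (L C : ℝ) : Prop where
  isCompact : IsCompact 𝒲
  convex : Convex ℝ 𝒲
  interior_nonempty : (interior 𝒲).Nonempty
  continuous_pred : ∀ t, Continuous (g t)
  image_pred : ∀ t, g t '' 𝒲 = Icc (a t) (b t)
  lt : ∀ t, a t < b t
  continuous_loss : ∀ t, Continuous (f t)
  loss_nonneg : ∀ t y, 0 ≤ f t y
  loss_le : ∀ t y, f t y ≤ C
  convexOn_loss : ∀ t, ConvexOn ℝ (Icc (a t) (b t)) (f t)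
  lipschitz_loss : ∀ t, ∀ y ∈ Icc (a t) (b t), ∀ z ∈ Icc (a t) (b t), |f t y - f t z| ≤ L * |y - z|

theorem lt_integral_of_absolutelyContinuous {E : Type*} [NormedAddCommGroup E] [NormedSpace ℝ E]
    [MeasurableSpace E] [BorelSpace E] {ν p : Measure E} [ν.IsOpenPosMeasure]
    [IsProbabilityMeasure p] {𝒲 : Set E} (hconv : Convex ℝ 𝒲) (hint : (interior 𝒲).Nonempty)
    (hp : ν[|𝒲] ≪ p) (h𝒲 : MeasurableSet 𝒲) (h𝒲top : ν 𝒲 ≠ ⊤) {g : E → ℝ} (hg : Continuous g)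
    (hgi : Integrable g p) {a : ℝ} (ha : ∀ᵐ u ∂p, a ≤ g u) {x : E} (hx : x ∈ 𝒲) (hax : a < g x) :
    a < ∫ u, g u ∂p := by
  have hge : 0 ≤ ∫ u, (g u - a) ∂p := integral_nonneg_of_ae (ha.mono fun u hu => sub_nonneg.2 hu)
  have heq : ∫ u, (g u - a) ∂p = ∫ u, g u ∂p - a := by
    rw [integral_sub hgi (integrable_const _)]; simp
  refine lt_of_le_of_ne (by linarith) fun hc => ?_
  have h0 : ∫ u, (g u - a) ∂p = 0 := by rw [heq, ← hc, sub_self]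
  rw [integral_eq_zero_iff_of_nonneg_ae (ha.mono fun u hu => sub_nonneg.2 hu)
    (hgi.sub (integrable_const _))] at h0
  have h1 : ν[|𝒲] {u | a < g u} = 0 :=
    measure_mono_null (fun u hu => by simpa [sub_eq_zero] using (ne_of_gt hu)) (hp.ae_le h0)
  rw [cond_apply h𝒲] at h1
  have hxc : x ∈ closure (interior 𝒲) := by
    rw [hconv.closure_interior_eq_closure_of_nonempty_interior hint]
    exact subset_closure hx
  obtain ⟨z, hz1, hz2⟩ := mem_closure_iff.1 hxc {u | a < g u} (isOpen_lt continuous_const hg) hax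
  have hpos : 0 < ν (𝒲 ∩ {u | a < g u}) :=
    lt_of_lt_of_le (((isOpen_interior.inter (isOpen_lt continuous_const hg))).measure_pos ν
      ⟨z, hz2, hz1⟩) (measure_mono (inter_subset_inter_left _ interior_subset))
  rcases mul_eq_zero.1 h1 with h | h
  · exact h𝒲top (ENNReal.inv_eq_zero.1 h)
  · exact hpos.ne' h

namespace RegularGame
variable {d : ℕ} {𝒲 : Set (EuclideanSpace ℝ (Fin d))} {g : ℕ → EuclideanSpace ℝ (Fin d) → ℝ}
  {f : ℕ → ℝ → ℝ} {a b : ℕ → ℝ} {L C η ε : ℝ}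

theorem mem_Icc (h : RegularGame 𝒲 g f a b L C) (t : ℕ) {u : EuclideanSpace ℝ (Fin d)}
    (hu : u ∈ 𝒲) : g t u ∈ Icc (a t) (b t) :=
  h.image_pred t ▸ mem_image_of_mem _ hu

theorem volume_ne_zero (h : RegularGame 𝒲 g f a b L C) : volume 𝒲 ≠ 0 :=
  ((isOpen_interior.measure_pos volume h.interior_nonempty).trans_le
    (measure_mono interior_subset)).ne'

theorem isProbabilityMeasure_cond (h : RegularGame 𝒲 g f a b L C) :
    IsProbabilityMeasure (volume[|𝒲]) :=
  cond_isProbabilityMeasure_of_finite h.volume_ne_zero h.isCompact.measure_lt_top.ne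

theorem mean_mem (h : RegularGame 𝒲 g f a b L C) (t : ℕ)
    {p : Measure (EuclideanSpace ℝ (Fin d))} [IsProbabilityMeasure p]
    (hp : volume[|𝒲] ≪ p) (hp' : ∀ᵐ u ∂p, u ∈ 𝒲) :
    ∫ z, z ∂(p.map (g t)) ∈ Ioo (a t) (b t) := by
  have hg := h.continuous_pred t
  have hpG : ∀ᵐ u ∂p, g t u ∈ Icc (a t) (b t) := hp'.mono fun u hu => h.mem_Icc t hu
  have hgi : Integrable (g t) p :=
    Integrable.of_bound hg.aestronglyMeasurable (max |a t| |b t|)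
      (hpG.mono fun z hz => abs_le_max_abs_abs hz.1 hz.2)
  rw [integral_map (f := fun z => z) hg.aemeasurable measurable_id.aestronglyMeasurable]
  obtain ⟨xa, hxa, hxa'⟩ := (h.image_pred t).symm ▸ left_mem_Icc.2 (h.lt t).le
  obtain ⟨xb, hxb, hxb'⟩ := (h.image_pred t).symm ▸ right_mem_Icc.2 (h.lt t).le
  have hm := h.isCompact.measurableSet
  have htop := (h.isCompact.measure_lt_top (μ := volume)).ne
  constructor
  · exact lt_integral_of_absolutelyContinuous h.convex h.interior_nonempty hp hm htop hg hgi
      (hpG.mono fun u hu => hu.1) hxb (hxb' ▸ h.lt t)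
  · have := lt_integral_of_absolutelyContinuous h.convex h.interior_nonempty hp hm htop hg.neg
      hgi.neg (a := -b t) (hpG.mono fun u hu => neg_le_neg hu.2) hxa
      (by rw [Pi.neg_apply, hxa']; exact neg_lt_neg (h.lt t))
    simp only [Pi.neg_apply, integral_neg] at this
    exact neg_lt_neg_iff.1 this

/-- The weights as a function of the sampled predictions alone. -/
noncomputable def pathWeights (𝒲 : Set (EuclideanSpace ℝ (Fin d)))
    (g : ℕ → EuclideanSpace ℝ (Fin d) → ℝ) (f : ℕ → ℝ → ℝ) (η ε : ℝ) (y : ℕ → ℝ) (t : ℕ) :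
    Measure (EuclideanSpace ℝ (Fin d)) :=
  weights 𝒲 g η ε y (fun s => f s (y s)) t

/-- The loss estimator of round `t` after the history `y`, if the prediction `z` is sampled. -/
noncomputable def pathEstimate (𝒲 : Set (EuclideanSpace ℝ (Fin d)))
    (g : ℕ → EuclideanSpace ℝ (Fin d) → ℝ) (f : ℕ → ℝ → ℝ) (η ε : ℝ) (t : ℕ) (y : ℕ → ℝ)
    (z : ℝ) (u : EuclideanSpace ℝ (Fin d)) : ℝ :=
  lossEstimate 𝒲 (g t) (pathWeights 𝒲 g f η ε y t) ε z (f t z) u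

theorem pathWeights_succ (y : ℕ → ℝ) (t : ℕ) : pathWeights 𝒲 g f η ε y (t + 1) =
    (pathWeights 𝒲 g f η ε y t).tilted fun u => -η * pathEstimate 𝒲 g f η ε t y (y t) u := rfl

section lossEstimate
variable {p : Measure (EuclideanSpace ℝ (Fin d))}

theorem lossEstimate_eq (h : RegularGame 𝒲 g f a b L C) (t : ℕ) (z v : ℝ)
    (u : EuclideanSpace ℝ (Fin d)) : lossEstimate 𝒲 (g t) p ε z v u =
      v / smoothedDensity (Icc (a t) (b t)) (p.map (g t)) ε z *
        smoothingKernel (Icc (a t) (b t)) (p.map (g t)) ε z (g t u) := by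
  rw [lossEstimate, h.image_pred]

theorem measurable_lossEstimate (h : RegularGame 𝒲 g f a b L C) (hε : 0 < ε) (t : ℕ)
    (hm : ∫ z, z ∂(p.map (g t)) ∈ Ioo (a t) (b t)) (z v : ℝ) :
    Measurable (lossEstimate 𝒲 (g t) p ε z v) := by
  have hk : Measurable fun u => smoothingKernel (Icc (a t) (b t)) (p.map (g t)) ε z (g t u) :=
    (measurable_smoothingKernel hm.1 hm.2 hε).comp
      (measurable_const.prodMk (h.continuous_pred t).measurable)
  rw [funext (h.lossEstimate_eq t z v)]
  exact hk.const_mul _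

theorem lossEstimate_nonneg (h : RegularGame 𝒲 g f a b L C) (hε : 0 < ε) (t : ℕ)
    (hm : ∫ z, z ∂(p.map (g t)) ∈ Ioo (a t) (b t)) (z : ℝ) (u : EuclideanSpace ℝ (Fin d)) :
    0 ≤ lossEstimate 𝒲 (g t) p ε z (f t z) u := by
  rw [h.lossEstimate_eq]
  exact mul_nonneg (div_nonneg (h.loss_nonneg t z) (smoothedDensity_nonneg hm.1 hm.2 hε z))
    (smoothingKernel_nonneg hm.1 hm.2 hε z _)

end lossEstimate

theorem pathWeights_spec (h : RegularGame 𝒲 g f a b L C) (hε : 0 < ε) (hη : 0 < η) (y : ℕ → ℝ)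
    (t : ℕ) : IsProbabilityMeasure (pathWeights 𝒲 g f η ε y t) ∧
      volume[|𝒲] ≪ pathWeights 𝒲 g f η ε y t := by
  induction t with
  | zero => exact ⟨h.isProbabilityMeasure_cond, .refl _⟩
  | succ t ih =>
    obtain ⟨h1, h2⟩ := ih
    have hm := h.mean_mem t h2 (weights_ae_mem h.isCompact.measurableSet g _ _ t)
    have hint : Integrable
        (fun u => Real.exp (-η * pathEstimate 𝒲 g f η ε t y (y t) u))
        (pathWeights 𝒲 g f η ε y t) := by
      simpa only [neg_mul] using integrable_exp_neg
        (φ := fun u => η * pathEstimate 𝒲 g f η ε t y (y t) u)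
        ((h.measurable_lossEstimate hε t hm _ _).const_mul _)
        fun u => mul_nonneg hη.le (h.lossEstimate_nonneg hε t hm _ _)
    rw [pathWeights_succ]
    exact ⟨isProbabilityMeasure_tilted hint, h2.trans (absolutelyContinuous_tilted hint)⟩

theorem pathWeights_ae_mem (h : RegularGame 𝒲 g f a b L C) (y : ℕ → ℝ) (t : ℕ) :
    ∀ᵐ u ∂(pathWeights 𝒲 g f η ε y t), u ∈ 𝒲 :=
  weights_ae_mem h.isCompact.measurableSet g _ _ t

theorem pathWeights_mean_mem (h : RegularGame 𝒲 g f a b L C) (hε : 0 < ε) (hη : 0 < η)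
    (y : ℕ → ℝ) (t : ℕ) :
    ∫ z, z ∂((pathWeights 𝒲 g f η ε y t).map (g t)) ∈ Ioo (a t) (b t) := by
  obtain ⟨h1, h2⟩ := h.pathWeights_spec hε hη y t
  exact h.mean_mem t h2 (h.pathWeights_ae_mem y t)

theorem measurable_pathEstimate_of_measurable (h : RegularGame 𝒲 g f a b L C) (hε : 0 < ε)
    (hη : 0 < η) (t : ℕ) (hW : Measurable fun y => pathWeights 𝒲 g f η ε y t) :
    Measurable fun x : ((ℕ → ℝ) × ℝ) × EuclideanSpace ℝ (Fin d) =>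
      pathEstimate 𝒲 g f η ε t x.1.1 x.1.2 x.2 := by
  let K : Kernel (ℕ → ℝ) (EuclideanSpace ℝ (Fin d)) := ⟨_, hW⟩
  have : IsMarkovKernel K := ⟨fun y => (h.pathWeights_spec hε hη y t).1⟩
  have hg := (h.continuous_pred t).measurable
  set m : (ℕ → ℝ) → ℝ := fun y => ∫ z, z ∂((pathWeights 𝒲 g f η ε y t).map (g t)) with hm
  have hmm : Measurable m := by
    have : m = fun y => ∫ u, g t u ∂(K y) :=
      funext fun y => integral_map hg.aemeasurable measurable_id.aestronglyMeasurable
    rw [this]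
    exact hg.stronglyMeasurable.integral_kernel.measurable
  have hk : Measurable fun x : ((ℕ → ℝ) × ℝ) × EuclideanSpace ℝ (Fin d) =>
      smoothingKernel (Icc (a t) (b t)) ((pathWeights 𝒲 g f η ε x.1.1 t).map (g t)) ε
        x.1.2 (g t x.2) := by
    have e : (fun x : ((ℕ → ℝ) × ℝ) × EuclideanSpace ℝ (Fin d) =>
      smoothingKernel (Icc (a t) (b t)) ((pathWeights 𝒲 g f η ε x.1.1 t).map (g t)) ε
        x.1.2 (g t x.2)) = fun x => _ := funext fun x =>
      smoothingKernel_Icc (h.pathWeights_mean_mem hε hη x.1.1 t).1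
        (h.pathWeights_mean_mem hε hη x.1.1 t).2 hε x.1.2 (g t x.2)
    rw [e]
    have hc : Measurable fun x : ((ℕ → ℝ) × ℝ) × EuclideanSpace ℝ (Fin d) =>
        (m x.1.1, x.1.2, g t x.2) := by fun_prop
    have h1 := (measurable_segment_kernel (a t) ε).comp hc
    simpa only [Function.comp_def] using h1
  have hκ : Measurable fun x : (ℕ → ℝ) × ℝ =>
      smoothedDensity (Icc (a t) (b t)) ((pathWeights 𝒲 g f η ε x.1 t).map (g t)) ε x.2 := by
    have e : (fun x : (ℕ → ℝ) × ℝ =>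
        smoothedDensity (Icc (a t) (b t)) ((pathWeights 𝒲 g f η ε x.1 t).map (g t)) ε x.2) =
        fun x => ∫ u, smoothingKernel (Icc (a t) (b t))
          ((pathWeights 𝒲 g f η ε x.1 t).map (g t)) ε x.2 (g t u) ∂(Kernel.prodMkRight ℝ K x) := by
      ext x
      have hm := h.pathWeights_mean_mem hε hη x.1 t
      exact integral_map hg.aemeasurable ((measurable_smoothingKernel hm.1 hm.2 hε).comp
        (measurable_const.prodMk measurable_id)).aestronglyMeasurable
    rw [e]
    exact hk.stronglyMeasurable.integral_kernel_prod_right'.measurable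
  have e : (fun x : ((ℕ → ℝ) × ℝ) × EuclideanSpace ℝ (Fin d) =>
      pathEstimate 𝒲 g f η ε t x.1.1 x.1.2 x.2) = fun x => _ :=
    funext fun x => h.lossEstimate_eq t x.1.2 (f t x.1.2) x.2
  rw [e]
  exact ((((h.continuous_loss t).measurable.comp measurable_fst.snd)).div
    (hκ.comp measurable_fst)).mul hk

theorem measurable_pathWeights (h : RegularGame 𝒲 g f a b L C) (hε : 0 < ε) (hη : 0 < η)
    (t : ℕ) : Measurable fun y => pathWeights 𝒲 g f η ε y t := by
  induction t with
  | zero => exact measurable_const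
  | succ t ih =>
    let K : Kernel (ℕ → ℝ) (EuclideanSpace ℝ (Fin d)) := ⟨_, ih⟩
    have : IsMarkovKernel K := ⟨fun y => (h.pathWeights_spec hε hη y t).1⟩
    have hφ : Measurable fun x : (ℕ → ℝ) × EuclideanSpace ℝ (Fin d) =>
        pathEstimate 𝒲 g f η ε t x.1 (x.1 t) x.2 :=
      (h.measurable_pathEstimate_of_measurable hε hη t ih).comp
        (g := fun x : ((ℕ → ℝ) × ℝ) × EuclideanSpace ℝ (Fin d) =>
          pathEstimate 𝒲 g f η ε t x.1.1 x.1.2 x.2)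
        (f := fun x : (ℕ → ℝ) × EuclideanSpace ℝ (Fin d) => ((x.1, x.1 t), x.2)) (by fun_prop)
    have hexp : Measurable fun x : (ℕ → ℝ) × EuclideanSpace ℝ (Fin d) =>
        Real.exp (-η * pathEstimate 𝒲 g f η ε t x.1 (x.1 t) x.2) := (hφ.const_mul _).exp
    have hZ : Measurable fun y : ℕ → ℝ =>
        ∫ u, Real.exp (-η * pathEstimate 𝒲 g f η ε t y (y t) u) ∂(K y) :=
      hexp.stronglyMeasurable.integral_kernel_prod_right'.measurable
    have hdens : Measurable (Function.uncurry fun (y : ℕ → ℝ) (u : EuclideanSpace ℝ (Fin d)) =>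
        ENNReal.ofReal (Real.exp (-η * pathEstimate 𝒲 g f η ε t y (y t) u) /
          ∫ u, Real.exp (-η * pathEstimate 𝒲 g f η ε t y (y t) u) ∂(K y))) :=
      (hexp.div (hZ.comp measurable_fst)).ennreal_ofReal
    have e : (fun y => pathWeights 𝒲 g f η ε y (t + 1)) = fun y => Kernel.withDensity K _ y :=
      funext fun y => (Kernel.withDensity_apply K hdens y).symm
    rw [e]
    exact Kernel.measurable _

theorem measurable_pathEstimate (h : RegularGame 𝒲 g f a b L C) (hε : 0 < ε)
    (hη : 0 < η) (t : ℕ) :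
    Measurable fun x : ((ℕ → ℝ) × ℝ) × EuclideanSpace ℝ (Fin d) =>
      pathEstimate 𝒲 g f η ε t x.1.1 x.1.2 x.2 :=
  h.measurable_pathEstimate_of_measurable hε hη t (h.measurable_pathWeights hε hη t)

/-- The excess of the loss over the regret of round `t` that exponential weights control. -/
noncomputable def roundCost (𝒲 : Set (EuclideanSpace ℝ (Fin d)))
    (g : ℕ → EuclideanSpace ℝ (Fin d) → ℝ) (f : ℕ → ℝ → ℝ) (η ε : ℝ)
    (pstar : Measure (EuclideanSpace ℝ (Fin d))) (t : ℕ) (y : ℕ → ℝ) (z : ℝ) : ℝ :=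
  (f t z - ∫ u, pathEstimate 𝒲 g f η ε t y z u ∂(pathWeights 𝒲 g f η ε y t)) +
    ∫ u, pathEstimate 𝒲 g f η ε t y z u ∂pstar +
    η / 2 * ∫ u, pathEstimate 𝒲 g f η ε t y z u ^ 2 ∂(pathWeights 𝒲 g f η ε y t)

theorem measurable_roundCost (h : RegularGame 𝒲 g f a b L C) (hε : 0 < ε) (hη : 0 < η)
    (pstar : Measure (EuclideanSpace ℝ (Fin d))) [SFinite pstar] (t : ℕ) :
    Measurable fun x : (ℕ → ℝ) × ℝ => roundCost 𝒲 g f η ε pstar t x.1 x.2 := by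
  let K : Kernel (ℕ → ℝ) (EuclideanSpace ℝ (Fin d)) := ⟨_, h.measurable_pathWeights hε hη t⟩
  have : IsMarkovKernel K := ⟨fun y => (h.pathWeights_spec hε hη y t).1⟩
  have hφ := h.measurable_pathEstimate hε hη t
  have h1 : Measurable fun x : (ℕ → ℝ) × ℝ =>
      ∫ u, pathEstimate 𝒲 g f η ε t x.1 x.2 u ∂(Kernel.prodMkRight ℝ K x) :=
    hφ.stronglyMeasurable.integral_kernel_prod_right'.measurable
  have h2 : Measurable fun x : (ℕ → ℝ) × ℝ => ∫ u, pathEstimate 𝒲 g f η ε t x.1 x.2 u ∂pstar :=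
    hφ.stronglyMeasurable.integral_prod_right'.measurable
  have h3 : Measurable fun x : (ℕ → ℝ) × ℝ =>
      ∫ u, pathEstimate 𝒲 g f η ε t x.1 x.2 u ^ 2 ∂(Kernel.prodMkRight ℝ K x) :=
    (hφ.pow_const 2).stronglyMeasurable.integral_kernel_prod_right'.measurable
  exact ((((h.continuous_loss t).measurable.comp measurable_snd).sub h1).add h2).add
    (h3.const_mul _)

end RegularGame

theorem lintegral_comp_condDistrib {Ω S : Type*} [MeasurableSpace Ω] [MeasurableSpace S]
    {μ : Measure Ω} [IsFiniteMeasure μ] {X : Ω → S} {Y : Ω → ℝ} (hX : Measurable X)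
    (hY : Measurable Y) {F : S × ℝ → ENNReal} (hF : Measurable F) :
    ∫⁻ ω, F (X ω, Y ω) ∂μ = ∫⁻ ω, (∫⁻ z, F (X ω, z) ∂(condDistrib Y X μ (X ω))) ∂μ := by
  rw [← lintegral_map (f := F) (g := fun ω => (X ω, Y ω)) hF (hX.prodMk hY),
    ← compProd_map_condDistrib hY.aemeasurable, Measure.lintegral_compProd hF,
    lintegral_map hF.lintegral_kernel_prod_right' hX]

/-- The extension by zero of a history of length `t`. -/
def extendHistory (t : ℕ) (h : Fin t → ℝ) (s : ℕ) : ℝ := if hs : s < t then h ⟨s, hs⟩ else 0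

theorem measurable_extendHistory (t : ℕ) : Measurable (extendHistory t) := by
  refine measurable_pi_lambda _ fun s => ?_
  unfold extendHistory
  split_ifs
  · fun_prop
  · fun_prop

namespace RegularGame
variable {d : ℕ} {𝒲 : Set (EuclideanSpace ℝ (Fin d))} {g : ℕ → EuclideanSpace ℝ (Fin d) → ℝ}
  {f : ℕ → ℝ → ℝ} {a b : ℕ → ℝ} {L C η ε : ℝ}

theorem pathWeights_extendHistory (h : RegularGame 𝒲 g f a b L C) (t : ℕ) (y : ℕ → ℝ) :
    pathWeights 𝒲 g f η ε (extendHistory t fun s => y s) t = pathWeights 𝒲 g f η ε y t := by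
  have key : ∀ s < t, extendHistory t (fun s => y s) s = y s := fun s hs => by
    simp [extendHistory, hs]
  exact weights_congr h.isCompact.measurableSet (fun _ _ _ _ => rfl) key
    fun s hs => by rw [key s hs]

theorem roundCost_extendHistory (h : RegularGame 𝒲 g f a b L C) (t : ℕ) (y : ℕ → ℝ)
    (pstar : Measure (EuclideanSpace ℝ (Fin d))) (z : ℝ) :
    roundCost 𝒲 g f η ε pstar t (extendHistory t fun s => y s) z =
      roundCost 𝒲 g f η ε pstar t y z := by
  simp only [roundCost, pathEstimate, h.pathWeights_extendHistory]

theorem sum_loss_le_sum_roundCost (h : RegularGame 𝒲 g f a b L C) (hε : 0 < ε) (hη : 0 < η)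
    {A : Set (EuclideanSpace ℝ (Fin d))} (hA0 : volume[|𝒲] A ≠ 0) (T : ℕ) (y : ℕ → ℝ) :
    ∑ t ∈ Finset.range T, f t (y t) ≤ -Real.log ((volume[|𝒲]).real A) / η +
      ∑ t ∈ Finset.range T, roundCost 𝒲 g f η ε ((volume[|𝒲])[|A]) t y (y t) := by
  have : IsProbabilityMeasure (pathWeights 𝒲 g f η ε y 0) := (h.pathWeights_spec hε hη y 0).1
  have hbound : ∀ t u, pathEstimate 𝒲 g f η ε t y (y t) u ≤
      f t (y t) / smoothedDensity (Icc (a t) (b t)) ((pathWeights 𝒲 g f η ε y t).map (g t)) ε (y t)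
        * kernelBound (a t) (b t) (∫ z, z ∂((pathWeights 𝒲 g f η ε y t).map (g t))) ε (y t) := by
    intro t u
    have hm := h.pathWeights_mean_mem hε hη y t
    rw [pathEstimate, h.lossEstimate_eq]
    exact mul_le_mul_of_nonneg_left (smoothingKernel_le hm.1 hm.2 hε _ _)
      (div_nonneg (h.loss_nonneg t _) (smoothedDensity_nonneg hm.1 hm.2 hε _))
  have hreg := expWeights_regret (p := pathWeights 𝒲 g f η ε y)
    (φ := fun t u => pathEstimate 𝒲 g f η ε t y (y t) u) hη (fun t => pathWeights_succ y t)
    (fun t => h.measurable_lossEstimate hε t (h.pathWeights_mean_mem hε hη y t) _ _)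
    (fun t u => h.lossEstimate_nonneg hε t (h.pathWeights_mean_mem hε hη y t) _ _)
    hbound (A := A) hA0 T
  simp only [roundCost, add_assoc]
  rw [Finset.sum_add_distrib, Finset.sum_sub_distrib]
  have e : pathWeights 𝒲 g f η ε y 0 = volume[|𝒲] := rfl
  rw [e] at hreg
  linarith

/-- The regret bound for a run of kernelized exponential weights against a regular game, in terms
of a comparator set `A`. -/
theorem sum_integral_loss_le (h : RegularGame 𝒲 g f a b L C) (hε : 0 < ε) (hη : 0 < η)
    (hL : 0 ≤ L) {A : Set (EuclideanSpace ℝ (Fin d))} (hA : MeasurableSet A) (hA𝒲 : A ⊆ 𝒲)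
    (hA0 : volume[|𝒲] A ≠ 0) {r : ℝ} (hr : 1 ≤ r) (hbr : ∀ t, (b t - a t) / ε ≤ r)
    {c : ℕ → ℝ} (hc : ∀ t, ∀ u ∈ A, f t (g t u) ≤ c t)
    {Ω : Type*} [MeasurableSpace Ω] {μ : Measure Ω} [IsProbabilityMeasure μ] {T : ℕ}
    {y : ℕ → Ω → ℝ} (hy : ∀ t < T, Measurable (y t))
    (hsample : ∀ t < T, ∀ᵐ ω ∂μ,
      condDistrib (y t) (fun ω' (s : Fin t) => y s ω') μ (fun s : Fin t => y s ω) =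
        smoothedLaw (Icc (a t) (b t))
          ((pathWeights 𝒲 g f η ε (fun s => y s ω) t).map (g t)) ε) :
    ∑ t ∈ Finset.range T, ∫ ω, f t (y t ω) ∂μ ≤ -Real.log ((volume[|𝒲]).real A) / η +
      ∑ t ∈ Finset.range T, (1 / 2 * ∫ ω, f t (y t ω) ∂μ +
        (c t / 2 + 3 / 2 * (L * ε) + η / 2 * (C ^ 2 * (2 * (1 + Real.log r))))) := by
  have hp0 := h.isProbabilityMeasure_cond
  have hpA : IsProbabilityMeasure ((volume[|𝒲])[|A]) := cond_isProbabilityMeasure hA0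
  have hlog := Real.log_nonneg hr
  have hc0 : ∀ t, 0 ≤ c t := by
    intro t
    obtain ⟨u, hu⟩ := nonempty_of_measure_ne_zero hA0
    exact (h.loss_nonneg t _).trans (hc t u hu)
  have hfint : ∀ t < T, Integrable (fun ω => f t (y t ω)) μ := fun t ht =>
    integrable_of_nonneg_le ((h.continuous_loss t).measurable.comp (hy t ht))
      (fun ω => h.loss_nonneg t _) (fun ω => h.loss_le t _)
  have hext : ∀ (t : ℕ) (ω : Ω) (z : ℝ),
      roundCost 𝒲 g f η ε ((volume[|𝒲])[|A]) t (extendHistory t fun s => y s ω) z =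
        roundCost 𝒲 g f η ε ((volume[|𝒲])[|A]) t (fun s => y s ω) z :=
    fun t ω z => h.roundCost_extendHistory t (fun s => y s ω) _ z
  have hround : ∀ t < T, ∫⁻ ω, ENNReal.ofReal
      (roundCost 𝒲 g f η ε ((volume[|𝒲])[|A]) t (fun s => y s ω) (y t ω)) ∂μ ≤
      ENNReal.ofReal (1 / 2 * ∫ ω, f t (y t ω) ∂μ +
        (c t / 2 + 3 / 2 * (L * ε) + η / 2 * (C ^ 2 * (2 * (1 + Real.log r))))) := by
    intro t ht
    have hX : Measurable fun ω (s : Fin t) => y s ω :=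
      measurable_pi_lambda _ fun s => hy s (s.2.trans ht)
    have hcost := (h.measurable_roundCost hε hη ((volume[|𝒲])[|A]) t).ennreal_ofReal
    have hF : Measurable fun x : (Fin t → ℝ) × ℝ => ENNReal.ofReal
        (roundCost 𝒲 g f η ε ((volume[|𝒲])[|A]) t (extendHistory t x.1) x.2) :=
      hcost.comp (((measurable_extendHistory t).comp measurable_fst).prodMk measurable_snd)
    have e1 := lintegral_comp_condDistrib (μ := μ) hX (hy t ht) hF
    have e2 := lintegral_comp_condDistrib (μ := μ) hX (hy t ht)
      (F := fun x => ENNReal.ofReal (f t x.2))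
      ((h.continuous_loss t).measurable.comp measurable_snd).ennreal_ofReal
    simp only [hext] at e1
    rw [e1, ENNReal.ofReal_add (mul_nonneg (by norm_num) (integral_nonneg fun ω =>
      h.loss_nonneg t _)) (by have := hc0 t; positivity), ENNReal.ofReal_mul (by norm_num),
      ofReal_integral_eq_lintegral_ofReal (hfint t ht) (.of_forall fun ω => h.loss_nonneg t _), e2]
    calc _ ≤ ∫⁻ ω, (ENNReal.ofReal (1 / 2) * (∫⁻ z, ENNReal.ofReal (f t z)
            ∂(condDistrib (y t) (fun ω' (s : Fin t) => y s ω') μ (fun s : Fin t => y s ω))) +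
          ENNReal.ofReal (c t / 2 + 3 / 2 * (L * ε) +
            η / 2 * (C ^ 2 * (2 * (1 + Real.log r))))) ∂μ := by
          refine lintegral_mono_ae ((hsample t ht).mono fun ω hω => ?_)
          rw [hω]
          obtain ⟨hprob, -⟩ := h.pathWeights_spec (η := η) hε hη (fun s => y s ω) t
          refine lintegral_round_le (h.continuous_pred t).measurable
            (h.pathWeights_mean_mem hε hη _ t) hε hL hη.le (hc0 t) (h.continuous_loss t)
            (h.loss_nonneg t) (h.loss_le t) (h.convexOn_loss t) (h.lipschitz_loss t) hr (hbr t)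
            ((h.pathWeights_ae_mem _ t).mono fun u hu => h.mem_Icc t hu)
            ((ae_cond_mem hA).mono fun u hu => ⟨h.mem_Icc t (hA𝒲 hu), hc t u hu⟩)
            (pathEstimate 𝒲 g f η ε t fun s => y s ω) ?_
          ext z u
          exact h.lossEstimate_eq t z (f t z) u
      _ = _ := by
          rw [lintegral_add_right _ measurable_const, lintegral_const_mul']
          · simp
          · simp
  have hsum : ENNReal.ofReal (∑ t ∈ Finset.range T, ∫ ω, f t (y t ω) ∂μ) ≤
      ENNReal.ofReal (-Real.log ((volume[|𝒲]).real A) / η +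
      ∑ t ∈ Finset.range T, (1 / 2 * ∫ ω, f t (y t ω) ∂μ +
        (c t / 2 + 3 / 2 * (L * ε) + η / 2 * (C ^ 2 * (2 * (1 + Real.log r)))))) := by
    have hK : 0 ≤ -Real.log ((volume[|𝒲]).real A) / η :=
      div_nonneg (neg_nonneg.2 (Real.log_nonpos measureReal_nonneg measureReal_le_one)) hη.le
    have hnn : ∀ t, 0 ≤ 1 / 2 * ∫ ω, f t (y t ω) ∂μ +
        (c t / 2 + 3 / 2 * (L * ε) + η / 2 * (C ^ 2 * (2 * (1 + Real.log r)))) := fun t => by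
      have h1 : 0 ≤ ∫ ω, f t (y t ω) ∂μ := integral_nonneg fun ω => h.loss_nonneg t _
      have h2 := hc0 t
      positivity
    rw [← integral_finsetSum _ fun t ht => hfint t (Finset.mem_range.1 ht)]
    calc _ ≤ ∫⁻ ω, ENNReal.ofReal (∑ t ∈ Finset.range T, f t (y t ω)) ∂μ :=
          ofReal_integral_le_lintegral _
      _ ≤ ∫⁻ ω, (ENNReal.ofReal (-Real.log ((volume[|𝒲]).real A) / η) +
          ∑ t ∈ Finset.range T, ENNReal.ofReal
            (roundCost 𝒲 g f η ε ((volume[|𝒲])[|A]) t (fun s => y s ω) (y t ω))) ∂μ := by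
          refine lintegral_mono fun ω => ?_
          refine (ENNReal.ofReal_le_ofReal
            (h.sum_loss_le_sum_roundCost hε hη hA0 T fun s => y s ω)).trans ?_
          refine ENNReal.ofReal_add_le.trans (add_le_add_right ?_ _)
          exact Finset.le_sum_of_subadditive _ ENNReal.ofReal_zero.le
            (fun _ _ => ENNReal.ofReal_add_le) _ _
      _ = ENNReal.ofReal (-Real.log ((volume[|𝒲]).real A) / η) +
          ∑ t ∈ Finset.range T, ∫⁻ ω, ENNReal.ofReal
            (roundCost 𝒲 g f η ε ((volume[|𝒲])[|A]) t (fun s => y s ω) (y t ω)) ∂μ := by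
          rw [lintegral_add_left measurable_const, lintegral_finsetSum']
          · simp
          · intro t ht
            have ht' := Finset.mem_range.1 ht
            have hX : Measurable fun ω (s : Fin t) => y s ω :=
              measurable_pi_lambda _ fun s => hy s (s.2.trans ht')
            have := (h.measurable_roundCost (η := η) hε hη ((volume[|𝒲])[|A]) t).comp
              (((measurable_extendHistory t).comp hX).prodMk (hy t ht'))
            simp only [Function.comp_def, hext] at this
            exact this.ennreal_ofReal.aemeasurable
      _ ≤ _ := by
          rw [ENNReal.ofReal_add hK (Finset.sum_nonneg fun t _ => hnn t),
            ENNReal.ofReal_sum_of_nonneg fun t _ => hnn t]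
          gcongr with t ht
          exact hround t (Finset.mem_range.1 ht)
  by_contra hcon
  rw [not_le] at hcon
  refine absurd hsum (not_le.2 ((ENNReal.ofReal_lt_ofReal_iff_of_nonneg ?_).2 hcon))
  refine add_nonneg (div_nonneg (neg_nonneg.2 (Real.log_nonpos measureReal_nonneg
    measureReal_le_one)) hη.le) (Finset.sum_nonneg fun t _ => ?_)
  have h1 : 0 ≤ ∫ ω, f t (y t ω) ∂μ := integral_nonneg fun ω => h.loss_nonneg t _
  have h2 := hc0 t
  positivity

end RegularGame

section extension
variable {d : ℕ} {𝒲 : Set (EuclideanSpace ℝ (Fin d))}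

theorem exists_continuous_extension {D : ℝ} (hD : 0 < D) (hcpt : IsCompact 𝒲)
    (hconv : Convex ℝ 𝒲) {g : EuclideanSpace ℝ (Fin d) → ℝ}
    (hlip : ∀ u ∈ 𝒲, ∀ v ∈ 𝒲, |g u - g v| ≤ D * ‖u - v‖) (hg : (g '' 𝒲).Nontrivial) :
    ∃ (g' : EuclideanSpace ℝ (Fin d) → ℝ) (a b : ℝ), Continuous g' ∧ EqOn g g' 𝒲 ∧ a < b ∧
      g' '' 𝒲 = Icc a b ∧ ∀ u v, |g' u - g' v| ≤ D * ‖u - v‖ := by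
  have h1 : LipschitzOnWith D.toNNReal g 𝒲 := LipschitzOnWith.of_dist_le_mul fun u hu v hv => by
    rw [Real.coe_toNNReal _ hD.le, Real.dist_eq, dist_eq_norm]; exact hlip u hu v hv
  obtain ⟨g', hg', heq⟩ := h1.extend_real
  have hcont := hg'.continuous
  have him : g' '' 𝒲 = g '' 𝒲 := heq.symm.image_eq
  have hne : 𝒲.Nonempty := hg.nonempty.of_image
  have hIcc : g' '' 𝒲 = Icc (sInf (g' '' 𝒲)) (sSup (g' '' 𝒲)) :=
    eq_Icc_of_connected_compact ((hconv.isConnected hne).image g' hcont.continuousOn)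
      (hcpt.image hcont)
  refine ⟨g', _, _, hcont, heq, ?_, hIcc, fun u v => ?_⟩
  · by_contra hc
    have : (g' '' 𝒲).Subsingleton := by
      rw [hIcc]; exact subsingleton_Icc_of_ge (not_lt.1 hc)
    rw [him] at this
    exact not_subsingleton_iff.2 hg this
  · have := hg'.dist_le_mul u v
    rwa [Real.coe_toNNReal _ hD.le, Real.dist_eq, dist_eq_norm] at this

theorem exists_regularGame {T : ℕ} (hT : 0 < T) {ℓ : ℕ → ℝ → ℝ}
    {g : ℕ → EuclideanSpace ℝ (Fin d) → ℝ} {α β L D C : ℝ} (hL : 0 < L) (hD : 0 < D)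
    (hcpt : IsCompact 𝒲) (hconv : Convex ℝ 𝒲) (hint : (interior 𝒲).Nonempty)
    (hℓ_range : ∀ t < T, ∀ z ∈ Set.Icc α β, ℓ t z ∈ Set.Icc 0 C)
    (hℓ_convex : ∀ t < T, ∀ w₁ ∈ 𝒲, ∀ w₂ ∈ 𝒲, ∀ c ∈ Set.Icc (0 : ℝ) 1,
      ℓ t (c * g t w₁ + (1 - c) * g t w₂) ≤ c * ℓ t (g t w₁) + (1 - c) * ℓ t (g t w₂))
    (hℓ_lip : ∀ t < T, ∀ w₁ ∈ 𝒲, ∀ w₂ ∈ 𝒲,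
      |ℓ t (g t w₁) - ℓ t (g t w₂)| ≤ L * |g t w₁ - g t w₂|)
    (hg_range : ∀ t < T, ∀ u ∈ 𝒲, g t u ∈ Set.Icc α β)
    (hg_lip : ∀ t < T, ∀ w₁ ∈ 𝒲, ∀ w₂ ∈ 𝒲, |g t w₁ - g t w₂| ≤ D * ‖w₁ - w₂‖)
    (hg_nonconst : ∀ t < T, (g t '' 𝒲).Nontrivial) :
    ∃ (g' : ℕ → EuclideanSpace ℝ (Fin d) → ℝ) (f : ℕ → ℝ → ℝ) (a b : ℕ → ℝ),
      RegularGame 𝒲 g' f a b L C ∧ (∀ t < T, EqOn (g t) (g' t) 𝒲) ∧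
      (∀ t < T, ∀ z ∈ Icc (a t) (b t), f t z = ℓ t z) ∧ (∀ t, Icc (a t) (b t) ⊆ Icc α β) ∧
      ∀ t u v, |g' t u - g' t v| ≤ D * ‖u - v‖ := by
  have key : ∀ t, ∃ (g' : EuclideanSpace ℝ (Fin d) → ℝ) (f : ℝ → ℝ) (a b : ℝ),
      (t < T → EqOn (g t) g' 𝒲) ∧ (t < T → ∀ z ∈ Icc a b, f z = ℓ t z) ∧
      Icc a b ⊆ Icc α β ∧ (∀ u v, |g' u - g' v| ≤ D * ‖u - v‖) ∧ Continuous g' ∧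
      g' '' 𝒲 = Icc a b ∧ a < b ∧ Continuous f ∧ (∀ y, 0 ≤ f y) ∧ (∀ y, f y ≤ C) ∧
      ConvexOn ℝ (Icc a b) f ∧ ∀ y ∈ Icc a b, ∀ z ∈ Icc a b, |f y - f z| ≤ L * |y - z| := by
    intro t
    set τ := if t < T then t else 0 with hτ
    have hτT : τ < T := by rw [hτ]; split_ifs with h <;> assumption
    have hτt : t < T → τ = t := fun h => if_pos h
    obtain ⟨g', a, b, hcont, heq, hab, him, hlip⟩ :=
      exists_continuous_extension hD hcpt hconv (hg_lip τ hτT) (hg_nonconst τ hτT)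
    have hmem : ∀ z ∈ Icc a b, ∃ u ∈ 𝒲, g τ u = z := by
      intro z hz
      rw [← him] at hz
      obtain ⟨u, hu, rfl⟩ := hz
      exact ⟨u, hu, heq hu⟩
    have hsub : Icc a b ⊆ Icc α β := by
      intro z hz
      obtain ⟨u, hu, rfl⟩ := hmem z hz
      exact hg_range τ hτT u hu
    have hLip : ∀ y ∈ Icc a b, ∀ z ∈ Icc a b, |ℓ τ y - ℓ τ z| ≤ L * |y - z| := by
      intro y hy z hz
      obtain ⟨u, hu, rfl⟩ := hmem y hy
      obtain ⟨v, hv, rfl⟩ := hmem z hz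
      exact hℓ_lip τ hτT u hu v hv
    have hcts : ContinuousOn (ℓ τ) (Icc a b) := by
      refine (LipschitzOnWith.of_dist_le_mul (K := L.toNNReal) fun y hy z hz => ?_).continuousOn
      rw [Real.coe_toNNReal _ hL.le, Real.dist_eq, Real.dist_eq]; exact hLip y hy z hz
    have hext : ∀ z ∈ Icc a b, IccExtend hab.le ((Icc a b).domRestrict (ℓ τ)) z = ℓ τ z :=
      fun z hz => by rw [IccExtend_of_mem _ _ hz]; rfl
    refine ⟨g', IccExtend hab.le ((Icc a b).domRestrict (ℓ τ)), a, b, fun ht => hτt ht ▸ heq,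
      fun ht z hz => by rw [hext z hz, hτt ht], hsub, hlip, hcont, him, hab,
      hcts.domRestrict.Icc_extend', fun y => ?_, fun y => ?_, ⟨convex_Icc a b, ?_⟩, ?_⟩
    · exact (hℓ_range τ hτT _ (hsub (projIcc a b hab.le y).2)).1
    · exact (hℓ_range τ hτT _ (hsub (projIcc a b hab.le y).2)).2
    · intro y hy z hz c c' hc hc' hcc
      rw [hext y hy, hext z hz, hext _ (convex_Icc a b hy hz hc hc' hcc)]
      obtain ⟨u, hu, rfl⟩ := hmem y hy
      obtain ⟨v, hv, rfl⟩ := hmem z hz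
      obtain rfl : c' = 1 - c := by linarith
      exact hℓ_convex τ hτT u hu v hv c ⟨hc, by linarith⟩
    · intro y hy z hz
      rw [hext y hy, hext z hz]
      exact hLip y hy z hz
  choose g' f a b h1 h2 h3 h4 h5 h6 h7 h8 h9 h10 h11 h12 using key
  exact ⟨g', f, a, b, ⟨hcpt, hconv, hint, h5, h6, h7, h8, h9, h10, h11, h12⟩, h1, h2, h3, h4⟩

end extension

section comparator
variable {d : ℕ} {𝒲 : Set (EuclideanSpace ℝ (Fin d))} {x : EuclideanSpace ℝ (Fin d)} {γ : ℝ}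

theorem homothety_image_subset (hconv : Convex ℝ 𝒲) (hx : x ∈ 𝒲) (hγ : γ ∈ Icc (0 : ℝ) 1) :
    AffineMap.homothety x γ '' 𝒲 ⊆ 𝒲 := by
  rintro _ ⟨u, hu, rfl⟩
  have := hconv.add_smul_sub_mem hx hu hγ
  rwa [AffineMap.homothety_apply, vsub_eq_sub, vadd_eq_add, add_comm]

theorem norm_sub_le_of_mem_homothety_image (hb : Bornology.IsBounded 𝒲) (hx : x ∈ 𝒲) (hγ : 0 ≤ γ)
    {u : EuclideanSpace ℝ (Fin d)} (hu : u ∈ AffineMap.homothety x γ '' 𝒲) :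
    ‖u - x‖ ≤ γ * Metric.diam 𝒲 := by
  obtain ⟨v, hv, rfl⟩ := hu
  rw [AffineMap.homothety_apply, vsub_eq_sub, vadd_eq_add, add_sub_cancel_right, norm_smul,
    Real.norm_of_nonneg hγ]
  gcongr
  rw [← dist_eq_norm]
  exact Metric.dist_le_diam_of_mem hb hv hx

theorem cond_volume_homothety_image (hcpt : IsCompact 𝒲) (hint : (interior 𝒲).Nonempty)
    (hconv : Convex ℝ 𝒲) (hx : x ∈ 𝒲) (hγ : γ ∈ Icc (0 : ℝ) 1) :
    volume[|𝒲] (AffineMap.homothety x γ '' 𝒲) = ENNReal.ofReal (γ ^ d) := by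
  have h0 : volume 𝒲 ≠ 0 := ((isOpen_interior.measure_pos volume hint).trans_le
    (measure_mono interior_subset)).ne'
  rw [cond_apply hcpt.measurableSet,
    inter_eq_self_of_subset_right (homothety_image_subset hconv hx hγ),
    Measure.addHaar_image_homothety, finrank_euclideanSpace_fin, abs_of_nonneg (pow_nonneg hγ.1 d),
    mul_comm, mul_assoc, ENNReal.mul_inv_cancel h0 hcpt.measure_lt_top.ne, mul_one]

end comparator

theorem two_mul_div_sqrt_add_sqrt_mul {N M : ℝ} (hN : 0 < N) (hM : 0 < M) :
    2 * (N / √(2 * N / M)) + √(2 * N / M) * M = 2 * √2 * √(N * M) := by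
  have hη : 0 < √(2 * N / M) := Real.sqrt_pos.2 (by positivity)
  have hsq : √(2 * N / M) ^ 2 * M = 2 * N := by
    rw [Real.sq_sqrt (by positivity)]; field_simp
  have h1 : √(2 * N / M) * M = √2 * √(N * M) := by
    rw [← Real.sqrt_mul (by norm_num), ← Real.sqrt_sq hM.le, ← Real.sqrt_mul (by positivity),
      Real.sqrt_sq hM.le]
    congr 1
    field_simp
  have h2 : 2 * (N / √(2 * N / M)) = √(2 * N / M) * M := by
    rw [← mul_div_assoc, div_eq_iff hη.ne']; linarith
  rw [h2, h1]; ring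

theorem isBigO_regretBound {d : ℕ} (hd : 0 < d) {L' L C α β : ℝ} (hL' : 0 < L') (hL : 0 < L)
    (hC : 0 < C) :
    (fun n : ℕ => regretBound d L' (varianceBound L α β n) C n) =O[atTop] (fun n : ℕ =>
      C * √(d * n * Real.log (L' * n)) * √(Real.log n)) := by
  have hlogtop : Tendsto (fun n : ℕ => Real.log n) atTop atTop :=
    Real.tendsto_log_atTop.comp tendsto_natCast_atTop_atTop
  have hlogtop' : Tendsto (fun n : ℕ => Real.log (L' * n)) atTop atTop :=
    Real.tendsto_log_atTop.comp (tendsto_natCast_atTop_atTop.const_mul_atTop hL')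
  refine IsBigO.of_bound (4 / C + 4 * √2) ?_
  filter_upwards [hlogtop.eventually_ge_atTop 1,
    hlogtop.eventually_ge_atTop (1 + Real.log (3 * L) + Real.log (β - α)),
    hlogtop'.eventually_ge_atTop 1, eventually_ge_atTop 1] with n h1 h2 h3 h4
  have hn : (1 : ℝ) ≤ n := by exact_mod_cast h4
  have hd1 : (1 : ℝ) ≤ d := by exact_mod_cast hd
  set s := √(d * n * Real.log (L' * n)) with hs
  have hs1 : 1 ≤ s := Real.one_le_sqrt.2 (one_le_mul_of_one_le_of_one_le
    (one_le_mul_of_one_le_of_one_le hd1 hn) h3)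
  have hl1 : 1 ≤ √(Real.log n) := Real.one_le_sqrt.2 h1
  have hB : varianceBound L α β n ≤ 4 * Real.log n := by
    unfold varianceBound
    rw [Real.log_mul (by positivity) (by positivity)]
    linarith
  have hsqrt : √(d * varianceBound L α β n * C ^ 2 * n * Real.log (L' * n)) ≤
      2 * (C * s * √(Real.log n)) := by
    refine Real.sqrt_le_iff.2 ⟨by positivity, ?_⟩
    rw [mul_pow, mul_pow, mul_pow, hs, Real.sq_sqrt (by positivity), Real.sq_sqrt (by positivity)]
    calc d * varianceBound L α β n * C ^ 2 * n * Real.log (L' * n)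
        = varianceBound L α β n * (d * C ^ 2 * n * Real.log (L' * n)) := by ring
      _ ≤ 4 * Real.log n * (d * C ^ 2 * n * Real.log (L' * n)) := by gcongr
      _ = _ := by ring
  have hprod : 1 ≤ s * √(Real.log n) := one_le_mul_of_one_le_of_one_le hs1 hl1
  rw [Real.norm_of_nonneg (by unfold regretBound; positivity), Real.norm_of_nonneg (by positivity)]
  unfold regretBound
  have hC4 : 4 ≤ 4 / C * (C * s * √(Real.log n)) := by
    rw [mul_assoc, ← mul_assoc (4 / C), div_mul_cancel₀ _ hC.ne']
    linarith
  have : 2 * √2 * √(d * varianceBound L α β n * C ^ 2 * n * Real.log (L' * n)) ≤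
      2 * √2 * (2 * (C * s * √(Real.log n))) := by gcongr
  linarith

end PseudoBandit

open PseudoBandit

theorem mainTheorem3 {d : ℕ} {X : Type*}
    (𝒲 : Set (EuclideanSpace ℝ (Fin d)))
    (h𝒲_closed : IsClosed 𝒲) (h𝒲_convex : Convex ℝ 𝒲) (h𝒲_bounded : Bornology.IsBounded 𝒲)
    (h𝒲_interior : (interior 𝒲).Nonempty)
    (T : ℕ) (ℓ : ℕ → ℝ → ℝ) (g : ℕ → EuclideanSpace ℝ (Fin d) → X → ℝ) (x : ℕ → X)
    (α β L D C : ℝ) (hL : 0 < L) (hD : 0 < D) (hC : 0 < C)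
    -- the losses take values in `[0, C]`, are convex and `L`-Lipschitz on the range of `g t`
    (hℓ_range : ∀ t < T, ∀ z ∈ Set.Icc α β, ℓ t z ∈ Set.Icc 0 C)
    (hℓ_convex : ∀ t < T, ∀ w₁ ∈ 𝒲, ∀ w₂ ∈ 𝒲, ∀ c ∈ Set.Icc (0 : ℝ) 1,
      ℓ t (c * g t w₁ (x t) + (1 - c) * g t w₂ (x t)) ≤
        c * ℓ t (g t w₁ (x t)) + (1 - c) * ℓ t (g t w₂ (x t)))
    (hℓ_lip : ∀ t < T, ∀ w₁ ∈ 𝒲, ∀ w₂ ∈ 𝒲,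
      |ℓ t (g t w₁ (x t)) - ℓ t (g t w₂ (x t))| ≤ L * |g t w₁ (x t) - g t w₂ (x t)|)
    -- the prediction functions take values in `[α, β]`, are `D`-Lipschitz, and not constant
    (hg_range : ∀ t < T, ∀ u ∈ 𝒲, g t u (x t) ∈ Set.Icc α β)
    (hg_lip : ∀ t < T, ∀ w₁ ∈ 𝒲, ∀ w₂ ∈ 𝒲, |g t w₁ (x t) - g t w₂ (x t)| ≤ D * ‖w₁ - w₂‖)
    (hg_nonconst : ∀ t < T, ((fun u => g t u (x t)) '' 𝒲).Nontrivial)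
    (L' : ℝ) (hL' : L' = L * D * Metric.diam 𝒲)
    -- the learning rate is defined and positive
    (hL'T : 1 < L' * T) (hB : 0 < PseudoBandit.varianceBound L α β T)
    {Ω : Type*} [MeasurableSpace Ω] (μ : Measure Ω) [IsProbabilityMeasure μ]
    (y : ℕ → Ω → ℝ) (w : ℕ → Ω → EuclideanSpace ℝ (Fin d))
    (hrun : PseudoBandit.IsRun 𝒲 (fun t u => g t u (x t)) ℓ
      (PseudoBandit.learningRate d L' (PseudoBandit.varianceBound L α β T) C T)
      (1 / (3 * L * T)) T μ y w) :
    (∀ t < T, Integrable (fun ω => ℓ t (g t (w t ω) (x t))) μ) ∧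
    (∃ wstar ∈ 𝒲,
      IsMinOn (fun u => ∑ t ∈ Finset.range T, ℓ t (g t u (x t))) 𝒲 wstar ∧
      PseudoBandit.expectedRegret (fun t u => g t u (x t)) ℓ T μ w wstar ≤
        PseudoBandit.regretBound d L' (PseudoBandit.varianceBound L α β T) C T) ∧
    (fun n : ℕ => PseudoBandit.regretBound d L' (PseudoBandit.varianceBound L α β n) C n)
      =O[atTop] (fun n : ℕ =>
        C * Real.sqrt (d * n * Real.log (L' * n)) * Real.sqrt (Real.log n)) := by
  have hT : 0 < T := Nat.pos_of_ne_zero fun h => by simp [h] at hL'T; linarith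
  have hTr : (0 : ℝ) < T := by exact_mod_cast hT
  have hL'pos : 0 < L' := by
    by_contra hc
    have := mul_nonpos_of_nonpos_of_nonneg (not_lt.1 hc) hTr.le
    linarith
  have hdpos : 0 < d := by
    rcases Nat.eq_zero_or_pos d with rfl | h
    · refine absurd (hg_nonconst 0 hT) (not_nontrivial_iff.2 ?_)
      exact (subsingleton_of_subsingleton (s := 𝒲)).image _
    · exact h
  have hcpt : IsCompact 𝒲 := Metric.isCompact_of_isClosed_isBounded h𝒲_closed h𝒲_bounded
  have hne : 𝒲.Nonempty := h𝒲_interior.mono interior_subset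
  obtain ⟨g', f, a, b, hgame, hgg', hfℓ, hsub, hg'lip⟩ :=
    exists_regularGame (g := fun t u => g t u (x t)) hT hL hD hcpt h𝒲_convex h𝒲_interior hℓ_range
      hℓ_convex hℓ_lip hg_range hg_lip hg_nonconst
  have hℓf : ∀ t < T, ∀ u ∈ 𝒲, ℓ t (g t u (x t)) = f t (g' t u) := fun t ht u hu => by
    rw [hfℓ t ht _ (hgame.mem_Icc t hu), ← hgg' t ht hu]
  have hae : ∀ᵐ ω ∂μ, ∀ t ∈ Finset.range T, w t ω ∈ 𝒲 ∧ g' t (w t ω) = y t ω :=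
    (eventually_all_finset _).2 fun t ht =>
      (hrun.action t (Finset.mem_range.1 ht)).mono fun ω hω =>
        ⟨hω.1, (hgg' t (Finset.mem_range.1 ht) hω.1).symm.trans hω.2⟩
  have hloss : ∀ t < T, (fun ω => ℓ t (g t (w t ω) (x t))) =ᵐ[μ] fun ω => f t (y t ω) :=
    fun t ht => hae.mono fun ω hω => by
      obtain ⟨h1, h2⟩ := hω t (Finset.mem_range.2 ht)
      simp only
      rw [hℓf t ht _ h1, h2]
  have hfint : ∀ t < T, Integrable (fun ω => f t (y t ω)) μ := fun t ht =>
    integrable_of_nonneg_le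
      ((hgame.continuous_loss t).measurable.comp (hrun.measurable_sample t ht))
      (fun ω => hgame.loss_nonneg t _) (fun ω => hgame.loss_le t _)
  refine ⟨fun t ht => (hfint t ht).congr (hloss t ht).symm, ?_,
    isBigO_regretBound hdpos hL'pos hL hC⟩
  obtain ⟨wstar, hwstar, hmin⟩ := hcpt.exists_isMinOn hne
    (f := fun u => ∑ t ∈ Finset.range T, f t (g' t u))
    (continuous_finsetSum _ fun t _ =>
      (hgame.continuous_loss t).comp (hgame.continuous_pred t)).continuousOn
  refine ⟨wstar, hwstar, fun u hu => ?_, ?_⟩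
  · simp only [mem_ofPred_eq]
    rw [Finset.sum_congr rfl fun t ht => hℓf t (Finset.mem_range.1 ht) _ hwstar,
      Finset.sum_congr rfl fun t ht => hℓf t (Finset.mem_range.1 ht) _ hu]
    exact hmin hu
  have hreg : expectedRegret (fun t u => g t u (x t)) ℓ T μ w wstar =
      ∑ t ∈ Finset.range T, ∫ ω, f t (y t ω) ∂μ -
        ∑ t ∈ Finset.range T, f t (g' t wstar) := by
    unfold expectedRegret
    rw [Finset.sum_congr rfl fun t ht => integral_congr_ae (hloss t (Finset.mem_range.1 ht)),
      Finset.sum_congr rfl fun t ht => hℓf t (Finset.mem_range.1 ht) _ hwstar]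
  rw [hreg]
  have hβα : 0 < β - α := by
    have h1 := hsub 0 (left_mem_Icc.2 (hgame.lt 0).le)
    have h2 := hsub 0 (right_mem_Icc.2 (hgame.lt 0).le)
    linarith [h1.1, h2.2, hgame.lt 0]
  set B := varianceBound L α β T with hBdef
  rcases lt_or_ge (3 * L * T * (β - α)) 1 with hr | hr
  · have hterm : ∀ t ∈ Finset.range T,
        ∫ ω, f t (y t ω) ∂μ ≤ f t (g' t wstar) + L * (β - α) := by
      intro t ht
      have ht' := Finset.mem_range.1 ht
      have : ∫ ω, f t (y t ω) ∂μ ≤ ∫ _, (f t (g' t wstar) + L * (β - α)) ∂μ := by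
        refine integral_mono_ae (hfint t ht') (integrable_const _) (hae.mono fun ω hω => ?_)
        obtain ⟨h1, h2⟩ := hω t ht
        have hyI : y t ω ∈ Icc (a t) (b t) := by
          rw [← h2]; exact hgame.mem_Icc t h1
        have hwI := hgame.mem_Icc t hwstar
        have h3 := (abs_le.1 (hgame.lipschitz_loss t _ hyI _ hwI)).2
        have h4 : |y t ω - g' t wstar| ≤ β - α :=
          abs_le.2 ⟨by linarith [(hsub t hyI).1, (hsub t hwI).2],
            by linarith [(hsub t hyI).2, (hsub t hwI).1]⟩
        have h5 := mul_le_mul_of_nonneg_left h4 hL.le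
        simp only
        linarith
      simpa using this
    have hsum := Finset.sum_le_sum hterm
    rw [Finset.sum_add_distrib, Finset.sum_const, Finset.card_range, nsmul_eq_mul] at hsum
    unfold regretBound
    have : 0 ≤ 2 * √2 * √(d * B * C ^ 2 * T * Real.log (L' * T)) := by positivity
    linarith
  have hε : 0 < 1 / (3 * L * T) := by positivity
  have hlogpos : 0 < Real.log (L' * T) := Real.log_pos hL'T
  have hη : 0 < learningRate d L' B C T := Real.sqrt_pos.2 (by positivity)
  have hsample : ∀ t < T, ∀ᵐ ω ∂μ,
      condDistrib (y t) (fun ω' (s : Fin t) => y s ω') μ (fun s : Fin t => y s ω) =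
        smoothedLaw (Icc (a t) (b t)) ((RegularGame.pathWeights 𝒲 g' f (learningRate d L' B C T)
          (1 / (3 * L * T)) (fun s => y s ω) t).map (g' t)) (1 / (3 * L * T)) := by
    intro t ht
    filter_upwards [hrun.sample t ht, hae] with ω h1 h2
    have hWeq : weights 𝒲 (fun t u => g t u (x t)) (learningRate d L' B C T) (1 / (3 * L * T))
        (fun s => y s ω) (fun s => ℓ s (g s (w s ω) (x s))) t =
        RegularGame.pathWeights 𝒲 g' f (learningRate d L' B C T)
          (1 / (3 * L * T)) (fun s => y s ω) t := by
      refine weights_congr hcpt.measurableSet (fun s hs => hgg' s (hs.trans ht))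
        (fun _ _ => rfl) fun s hs => ?_
      obtain ⟨h3, h4⟩ := h2 s (Finset.mem_range.2 (hs.trans ht))
      rw [hℓf s (hs.trans ht) _ h3, h4]
    rw [h1, hWeq, (hgg' t ht).image_eq, hgame.image_pred,
      Measure.map_congr ((hgame.pathWeights_ae_mem _ t).mono fun u hu => hgg' t ht hu)]
  have hγ : 1 / (L' * T) ∈ Icc (0 : ℝ) 1 :=
    ⟨by positivity, (div_le_one (by linarith)).2 hL'T.le⟩
  have hvol := cond_volume_homothety_image hcpt h𝒲_interior h𝒲_convex hwstar hγ
  have hmain := hgame.sum_integral_loss_le (A := AffineMap.homothety wstar (1 / (L' * T)) '' 𝒲)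
    (r := 3 * L * T * (β - α)) (c := fun t => f t (g' t wstar) + 1 / T) hε hη hL.le
    (hcpt.image (AffineMap.homothety_continuous _ _)).measurableSet
    (homothety_image_subset h𝒲_convex hwstar hγ)
    (by rw [hvol]; exact (ENNReal.ofReal_pos.2 (by positivity)).ne') hr
    (fun t => by
      have h1 := hsub t (left_mem_Icc.2 (hgame.lt t).le)
      have h2 := hsub t (right_mem_Icc.2 (hgame.lt t).le)
      rw [div_div_eq_mul_div, div_one, mul_comm]
      exact mul_le_mul_of_nonneg_left (by linarith [h1.1, h2.2]) (by positivity))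
    (fun t u hu => by
      have hu𝒲 := homothety_image_subset h𝒲_convex hwstar hγ hu
      have h1 := (abs_le.1 (hgame.lipschitz_loss t _ (hgame.mem_Icc t hu𝒲) _
        (hgame.mem_Icc t hwstar))).2
      have h2 := norm_sub_le_of_mem_homothety_image h𝒲_bounded hwstar hγ.1 hu
      have h3 : L * |g' t u - g' t wstar| ≤ 1 / T := by
        calc L * |g' t u - g' t wstar| ≤ L * (D * (1 / (L' * T) * Metric.diam 𝒲)) := by
              gcongr; exact (hg'lip t u wstar).trans (by gcongr)
          _ = L' * (1 / (L' * T)) := by rw [hL']; ring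
          _ = 1 / T := by field_simp
      linarith)
    hrun.measurable_sample hsample
  have hlogA : -Real.log ((volume[|𝒲]).real (AffineMap.homothety wstar (1 / (L' * T)) '' 𝒲)) =
      d * Real.log (L' * T) := by
    rw [measureReal_def, hvol, ENNReal.toReal_ofReal (by positivity), Real.log_pow, one_div,
      Real.log_inv]
    ring
  have hBlog : 2 * (1 + Real.log (3 * L * T * (β - α))) = B := by
    rw [Real.log_mul (by positivity) hβα.ne', hBdef, varianceBound]; ring
  rw [hlogA, hBlog, Finset.sum_add_distrib, Finset.sum_add_distrib, Finset.sum_add_distrib,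
    ← Finset.mul_sum, ← Finset.sum_div, Finset.sum_add_distrib, Finset.sum_const, Finset.sum_const,
    Finset.sum_const, Finset.card_range, nsmul_eq_mul, nsmul_eq_mul, nsmul_eq_mul] at hmain
  have e1 : (T : ℝ) * (1 / T) = 1 := by field_simp
  have e2 : (T : ℝ) * (3 / 2 * (L * (1 / (3 * L * T)))) = 1 / 2 := by field_simp
  have hopt := two_mul_div_sqrt_add_sqrt_mul (N := d * Real.log (L' * T)) (M := B * C ^ 2 * T)
    (by positivity) (by positivity)
  have hηeq : √(2 * (d * Real.log (L' * T)) / (B * C ^ 2 * T)) = learningRate d L' B C T := by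
    rw [learningRate]; congr 1; ring
  rw [hηeq] at hopt
  unfold regretBound
  rw [show d * B * C ^ 2 * T * Real.log (L' * T) =
    d * Real.log (L' * T) * (B * C ^ 2 * T) by ring, ← hopt]
  rw [e1, e2] at hmain
  linarith
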